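/- Let $r,s\ge 2$ and let $\mathfrak f_{s,r}$ be the free nilpotent real Lie algebra of rank $r$ and step $s$. Let a Hall enumeration be given: a complete list, indexed by $1,\dots,n$, of the formal brackets of degree at most $s$ produced by M. Hall's algorithm. That is: the first $r$ elements are the generators (of degree 1), elements of smaller degree come first, and $[i,j]$ is an element of the list if and only if $d(i)+d(j)\le s$, $i>j$, and $k\le j$ whenever $i$ was constructed as $[h,k]$. Each element $\ell$ is uniquely a left-nested bracket $[\cdots[[\ell_0,\ell_1],\ell_2],\dots,\ell_h]$ of elements of the list with $\ell_0\in\{1,\dots,r\}$ a generator ($h=0$ if $\ell$ is a generator). Let $I(\ell)\in\mathbb N^n$ be the multi-index with $I(\ell)_j=\#\{t\ge1:\ell_t=j\}$. For multi-indices write $|\alpha|=\sum_j\alpha_j$, $\alpha!=\prod_j\alpha_j!$, $x^\alpha=\prod_j x_j^{\alpha_j}$. Define polynomial vector fields on $\mathbb R^n$ by $$X_q=\sum_{\ell:\,\ell_0=q}\frac{(-1)^{|I(\ell)|}}{I(\ell)!}\,x^{I(\ell)}\frac{\partial}{\partial x_\ell}\qquad(q=1,\dots,r),$$ and $X_i=[X_h,X_k]$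 (commutator of vector fields) if the element $i$ was constructed as $[h,k]$. Let $\mathfrak g$ be the Lie algebra of vector fields generated by $X_1,\dots,X_r$ (the left-invariant vector fields of the free nilpotent Lie group in these coordinates). Then there is an isomorphism of Lie algebras $\mathfrak f_{s,r}\to\mathfrak g$ taking the generators to $X_1,\dots,X_r$, and $X_1,\dots,X_n$ is a basis of $\mathfrak g$. Let $c_{ij}^k,c_{i\alpha}^k\in\mathbb R$ ($\alpha\in\mathbb N^n$) be the structure constants and generalized structure constants of this basis, $$[X_i,X_j]=\sum_{k=1}^n c_{ij}^kX_k,\qquad [X_i,\underbrace{X_1,\dots,X_1}_{\alpha_1},\dots,\underbrace{X_n,\dots,X_n}_{\alpha_n}]=\sum_{k=1}^n c_{i\alpha}^kX_k$$ (left-nested iterated commutator), and for $v\in\mathbb R^n$ let $$P_i^v(x)=\sum_{\alpha\in\mathbb N^n}\frac{(-1)^{|\alpha|}}{\alpha!}\Big(\sum_{k=1}^n c_{i\alpha}^kv_k\Big)x^\alpha\qquad(i=1,\dots,n)$$ be the extremal polynomials. For each $i$, only finitely many $\alpha$ have $c_{i\alpha}^k\ne0$ for some $k$, so the sum is finite.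 Then for all $v\in\mathbb R^n$ and $i,j\in\{1,\dots,n\}$ $$X_iP_j^v=\sum_{k=1}^n c_{ij}^kP_k^v .$$ In particular $X_iP_i^v=0$, and the linear span of $P_1^v,\dots,P_n^v$ is mapped into itself by every vector field in $\mathfrak g$. -/

import Mathlib

open scoped BigOperators

noncomputable section

namespace HallGG

/-- Derivations of `ℝ[x₁,…,xₙ]`, that is, vector fields `∑ aₗ ∂/∂xₗ` on `ℝⁿ` with polynomial
coefficients; the Lie bracket is the commutator. -/
abbrev PolyField (n : ℕ) : Type :=
  Derivation ℝ (MvPolynomial (Fin n) ℝ) (MvPolynomial (Fin n) ℝ)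

/-- The free nilpotent real Lie algebra of rank `r` and step `s`: the free Lie algebra on `r`
generators modulo all commutators of length `s + 1` (in Mathlib's numbering
`lowerCentralSeries 0` is everything). -/
abbrev FreeNilpotent (r s : ℕ) : Type :=
  FreeLieAlgebra ℝ (Fin r) ⧸
    LieModule.lowerCentralSeries ℝ (FreeLieAlgebra ℝ (Fin r)) (FreeLieAlgebra ℝ (Fin r)) s

/-- The generators of the free nilpotent Lie algebra. -/
def FreeNilpotent.gen (r s : ℕ) (q : Fin r) : FreeNilpotent r s :=
  LieSubmodule.Quotient.mk (FreeLieAlgebra.of ℝ q)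

/-- `w` is an enumeration of the elements produced by M. Hall's algorithm for `r` generators and
step `s`. Elements are recorded as formal brackets: `FreeMagma.of q` is the `q`-th generator,
`x * y` is `[x, y]`, and the degree is `FreeMagma.length`. -/
structure IsHallEnumeration {r n : ℕ} (s : ℕ) (w : Fin n → FreeMagma (Fin r)) : Prop where
  injective : Function.Injective w
  rank_le : r ≤ n
  /-- the first `r` elements are the generators, in order -/
  gen : ∀ q : Fin r, w (Fin.castLE rank_le q) = FreeMagma.of q
  /-- elements of smaller degree come first -/
  lt_of_length_lt : ∀ i j : Fin n, (w i).length < (w j).length → i < j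
  /-- `[x, y]` belongs to the list iff its degree is at most `s`, `x = wᵢ` and `y = wⱼ` belong to
  the list, `i > j`, and `k ≤ j` in case `wᵢ` was constructed as `[w_h, w_k]` -/
  mul_mem_iff : ∀ x y : FreeMagma (Fin r), x * y ∈ Set.range w ↔
    x.length + y.length ≤ s ∧
      ∃ i j : Fin n, w i = x ∧ w j = y ∧ j < i ∧ ∀ h k : Fin n, w i = w h * w k → k ≤ j

/-- The index `ℓ₀` of a formal bracket `[⋯[[ℓ₀, ℓ₁], ℓ₂], …, ℓ_h]`. The generator `q` satisfies
`q ≺ ℓ` iff `ℓ₀ = q`. -/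
def root {r : ℕ} : FreeMagma (Fin r) → Fin r
  | .of q => q
  | .mul x _ => root x

/-- The multi-index `I(ℓ)` of a formal bracket `[⋯[[ℓ₀, ℓ₁], ℓ₂], …, ℓ_h]`: its `j`-th entry is the
number of `t ≥ 1` such that the `t`-th entry of the bracket is the `j`-th Hall element. -/
def multiIndex {r n : ℕ} (w : Fin n → FreeMagma (Fin r)) : FreeMagma (Fin r) → (Fin n →₀ ℕ)
  | .of _ => 0
  | .mul x y => by
      classical
      exact multiIndex w x + ∑ j : Fin n, if w j = y then Finsupp.single j 1 else 0

/-- `(-1)^{|α|} / α!` -/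
def signedInvFactorial {n : ℕ} (α : Fin n →₀ ℕ) : ℝ :=
  (-1) ^ (∑ j, α j) / ∏ j, ((α j).factorial : ℝ)

/-- The vector field `X_q = ∑_{ℓ : q ≺ ℓ} (-1)^{|I(ℓ)|} / I(ℓ)! x^{I(ℓ)} ∂/∂x_ℓ`, for a
generator `q`. -/
def generatorField {r n : ℕ} (w : Fin n → FreeMagma (Fin r)) (q : Fin r) : PolyField n :=
  MvPolynomial.mkDerivation ℝ fun l : Fin n =>
    if root (w l) = q then
      MvPolynomial.monomial (multiIndex w (w l)) (signedInvFactorial (multiIndex w (w l)))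
    else 0

/-- Evaluation of a formal bracket at the vector fields `X_q`. -/
def evalField {r n : ℕ} (w : Fin n → FreeMagma (Fin r)) : FreeMagma (Fin r) → PolyField n
  | .of q => generatorField w q
  | .mul x y => ⁅evalField w x, evalField w y⁆

/-- The `i`-th Hall–Grayson–Grossman vector field `X_i`. -/
def hallField {r n : ℕ} (w : Fin n → FreeMagma (Fin r)) (i : Fin n) : PolyField n :=
  evalField w (w i)

/-- The Lie algebra of vector fields generated by `X_1, …, X_r`. -/
def hallLie {r n : ℕ} (w : Fin n → FreeMagma (Fin r)) : LieSubalgebra ℝ (PolyField n) :=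
  LieSubalgebra.lieSpan ℝ (PolyField n) (Set.range (generatorField w))

section StructureConstants

variable {n : ℕ} {L : Type*} [LieRing L] [LieAlgebra ℝ L]

/-- `[Y, X_α] = [Y, X₁, …, X₁, X₂, …, X₂, …, Xₙ, …, Xₙ]`, a left-nested commutator in which `X_j`
occurs `α_j` times. -/
def iterBracket (X : Fin n → L) (Y : L) (α : Fin n →₀ ℕ) : L :=
  (List.finRange n).foldl (fun Z j => (fun W : L => ⁅W, X j⁆)^[α j] Z) Y

/-- The structure constants: `[X_i, X_j] = ∑ₖ c_{ij}^k X_k`. -/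
def structConst (X : Module.Basis (Fin n) ℝ L) (i j k : Fin n) : ℝ :=
  X.repr ⁅X i, X j⁆ k

/-- The generalized structure constants: `[X_i, X_α] = ∑ₖ c_{iα}^k X_k`. -/
def genStructConst (X : Module.Basis (Fin n) ℝ L) (i : Fin n) (α : Fin n →₀ ℕ) (k : Fin n) : ℝ :=
  X.repr (iterBracket X (X i) α) k

/-- `φ_{iα}(v) = (-1)^{|α|} / α! ∑ₖ c_{iα}^k v_k` -/
def phi (X : Module.Basis (Fin n) ℝ L) (i : Fin n) (α : Fin n →₀ ℕ) (v : Fin n → ℝ) : ℝ :=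
  signedInvFactorial α * ∑ k, genStructConst X i α k * v k

/-- The extremal polynomial `P_i^v(x) = ∑_α φ_{iα}(v) x^α`. -/
def extremalPoly (X : Module.Basis (Fin n) ℝ L) (v : Fin n → ℝ) (i : Fin n) :
    MvPolynomial (Fin n) ℝ :=
  ∑ᶠ α : Fin n →₀ ℕ, MvPolynomial.monomial α (phi X i α v)

end StructureConstants

end HallGG

end

open scoped BigOperators

noncomputable section

/-! The extremal polynomials are the values at the basis fields of one polynomial-valued functional
on 𝔤, F(Z) = v(e^{x_n ad X_n} ⋯ e^{x_1 ad X_1} Z): expanding the exponentials produces the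
generalized structure constants with their signs (`coeff_expFunctional_finRange`). The claim becomes
Y F(Z) = F([Y, Z]) for Y in 𝔤. This property is stable under brackets in Y, so the generators Y =
X_q suffice.

For a generator, let D be differentiation along X_q and let N_k be f ↦ x_k · f ∘ ad X_k, both acting
on functionals. Then F is e^{N_1} ⋯ e^{N_n} applied to the constant functional v, and D minus
precomposition with ad X_q has to kill it. Moving this operator past e^{N_k} is Lazard elimination
(`elimination_step`): the subtracted sum of (X_q x_i) ad X_i over an elimination set turns into the
same sum over the next set, in which k is dropped and the Hall elements [h, k, …, k] are adjoined.
The coefficients of X_q satisfy exactly the recursion this requires (`generatorField_X_mul`). The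
initial sum is ad X_q, the final one is empty, and D kills constants.

For the basis and the isomorphism: X_i equals ∂/∂x_i at the origin, whence independence
(`constantCoeff_hallField`); Hall's rewriting process gives spanning (`lie_mem_hallSpan`); a weight
filtration gives nilpotency (`lowerCentralSeries_hallLie_eq_bot`). The induced surjection from the
free nilpotent algebra sends a spanning family to an independent one, so it is injective. -/

namespace HallGG

/-! ### Formal brackets and their left-nested extensions -/

section Magma

theorem freeMagma_mul_inj {α : Type*} {x y x' y' : FreeMagma α} :
    x * y = x' * y' ↔ x = x' ∧ y = y' := by
  constructor
  · intro h
    have h' : FreeMagma.mul x y = FreeMagma.mul x' y' := h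
    injection h' with h₁ h₂
    exact ⟨h₁, h₂⟩
  · rintro ⟨rfl, rfl⟩
    rfl

theorem freeMagma_of_ne_mul {α : Type*} (q : α) (x y : FreeMagma α) : FreeMagma.of q ≠ x * y := by
  intro h
  have h' : FreeMagma.of q = FreeMagma.mul x y := h
  injection h'

theorem freeMagma_of_inj {α : Type*} {p q : α} (h : FreeMagma.of p = FreeMagma.of q) : p = q := by
  injection h

theorem freeMagma_length_mul {α : Type*} (x y : FreeMagma α) :
    (x * y).length = x.length + y.length := rfl

theorem root_mul {r : ℕ} (x y : FreeMagma (Fin r)) : root (x * y) = root x := rfl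

/-- `Extends x y` says that `y` is a left-nested bracket `[⋯[[x, y₁], y₂], …, yₘ]`. -/
def Extends {α : Type*} (x : FreeMagma α) : FreeMagma α → Prop
  | .of q => FreeMagma.of q = x
  | .mul y z => y * z = x ∨ Extends x y

theorem extends_of {α : Type*} (x : FreeMagma α) (q : α) :
    Extends x (FreeMagma.of q) ↔ FreeMagma.of q = x := Iff.rfl

theorem extends_mul {α : Type*} (x y z : FreeMagma α) :
    Extends x (y * z) ↔ y * z = x ∨ Extends x y := Iff.rfl

theorem Extends.refl {α : Type*} (x : FreeMagma α) : Extends x x := by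
  induction x with
  | ih1 q => rfl
  | ih2 x y _ _ => exact Or.inl rfl

theorem Extends.eq_or_length_lt {α : Type*} {x y : FreeMagma α} (h : Extends x y) :
    y = x ∨ x.length < y.length := by
  induction y with
  | ih1 q => exact Or.inl h
  | ih2 y z hy _ =>
    rcases (extends_mul x y z).1 h with h | h
    · exact Or.inl h
    · right
      rw [freeMagma_length_mul]
      have := z.length_pos
      rcases hy h with rfl | h' <;> omega

theorem Extends.of_mul_left {α : Type*} {x z y : FreeMagma α} (h : Extends (x * z) y) :
    Extends x y := by
  induction y with
  | ih1 q => exact absurd h (freeMagma_of_ne_mul _ _ _)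
  | ih2 y t hy _ =>
    rcases (extends_mul _ y t).1 h with h | h
    · obtain ⟨rfl, rfl⟩ := freeMagma_mul_inj.1 h
      exact Or.inr (Extends.refl _)
    · exact Or.inr (hy h)

theorem extends_of_iff_root {r : ℕ} (q : Fin r) (y : FreeMagma (Fin r)) :
    Extends (FreeMagma.of q) y ↔ root y = q := by
  induction y with
  | ih1 p =>
    rw [extends_of]
    exact ⟨fun h => freeMagma_of_inj h, fun h => congrArg _ h⟩
  | ih2 y z hy _ =>
    rw [extends_mul, root_mul, hy]
    exact ⟨fun h => h.resolve_left fun h => freeMagma_of_ne_mul _ _ _ h.symm, Or.inr⟩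

end Magma

/-! ### Combinatorics of Hall elements -/

section Hall

variable {r n s : ℕ} {w : Fin n → FreeMagma (Fin r)}

/-- If the `i`-th Hall element was constructed as `[h, l]`, then `l ≤ k`. -/
def FactorLE (w : Fin n → FreeMagma (Fin r)) (i k : Fin n) : Prop :=
  ∀ h l : Fin n, w i = w h * w l → l ≤ k

theorem multiIndex_of (q : Fin r) : multiIndex w (FreeMagma.of q) = 0 := rfl

theorem multiIndex_mul (hw : Function.Injective w) (x : FreeMagma (Fin r)) (j : Fin n) :
    multiIndex w (x * w j) = multiIndex w x + Finsupp.single j 1 := by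
  have h : multiIndex w (x * w j) = multiIndex w x +
      ∑ i : Fin n, (open Classical in if w i = w j then Finsupp.single i 1 else 0) := rfl
  rw [h, Finset.sum_eq_single j]
  · simp
  · intro b _ hb
    rw [if_neg fun h => hb (hw h)]
  · simp

namespace IsHallEnumeration

theorem mul_factors (hw : IsHallEnumeration s w) {i a b : Fin n} (h : w i = w a * w b) :
    b < a ∧ FactorLE w a b ∧ a < i ∧ b < i ∧ (w a).length + (w b).length ≤ s := by
  obtain ⟨hl, i', j', hi, hj, hlt, hf⟩ := (hw.mul_mem_iff (w a) (w b)).1 ⟨i, h⟩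
  have hi' := hw.injective hi
  have hj' := hw.injective hj
  subst hi' hj'
  have h1 := (w i').length_pos
  have h2 := (w j').length_pos
  have h3 := congrArg FreeMagma.length h
  rw [freeMagma_length_mul] at h3
  exact ⟨hlt, hf, hw.lt_of_length_lt _ _ (by omega), hw.lt_of_length_lt _ _ (by omega), hl⟩

theorem exists_mul (hw : IsHallEnumeration s w) {a b : Fin n} (hba : b < a) (hf : FactorLE w a b)
    (hl : (w a).length + (w b).length ≤ s) : ∃ i, w i = w a * w b :=
  (hw.mul_mem_iff (w a) (w b)).2 ⟨hl, a, b, rfl, rfl, hba, hf⟩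

theorem of_or_mul (hw : IsHallEnumeration s w) (i : Fin n) :
    (∃ q, w i = FreeMagma.of q) ∨ ∃ a b, w i = w a * w b := by
  generalize h : w i = x
  induction x with
  | ih1 q => exact Or.inl ⟨q, rfl⟩
  | ih2 x y _ _ =>
    right
    obtain ⟨_, a, b, ha, hb, _⟩ := (hw.mul_mem_iff x y).1 ⟨i, h⟩
    exact ⟨a, b, by rw [ha, hb]⟩

/-- Induction along the construction of Hall elements. -/
theorem hall_induction (hw : IsHallEnumeration s w) {p : Fin n → Prop}
    (of : ∀ i q, w i = FreeMagma.of q → p i)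
    (mul : ∀ i a b, w i = w a * w b → p a → p b → p i) (i : Fin n) : p i := by
  induction i using WellFoundedLT.induction with
  | ind i ih =>
    rcases hw.of_or_mul i with ⟨q, hq⟩ | ⟨a, b, hab⟩
    · exact of i q hq
    · obtain ⟨_, _, h1, h2, _⟩ := hw.mul_factors hab
      exact mul i a b hab (ih a h1) (ih b h2)

theorem length_le (hw : IsHallEnumeration s w) (hs : 1 ≤ s) (i : Fin n) : (w i).length ≤ s := by
  rcases hw.of_or_mul i with ⟨q, hq⟩ | ⟨a, b, hab⟩
  · rw [hq]; exact hs
  · rw [hab]; exact (hw.mul_factors hab).2.2.2.2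

theorem factorLE_self (hw : IsHallEnumeration s w) (i : Fin n) : FactorLE w i i :=
  fun _ _ h => (hw.mul_factors h).2.2.2.1.le

/-- The right factors of a Hall element weakly increase along its left nesting, so a bound on the
last one bounds them all. -/
theorem multiIndex_eq_zero (hw : IsHallEnumeration s w) {i k m : Fin n} (hf : FactorLE w i k)
    (hkm : k < m) : multiIndex w (w i) m = 0 := by
  induction i using hw.hall_induction generalizing k with
  | of i q h => rw [h]; rfl
  | mul i a b h iha _ =>
    have hb := hf a b h
    rw [h, multiIndex_mul hw.injective, Finsupp.add_apply, iha (hw.mul_factors h).2.1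
      (hb.trans_lt hkm), Finsupp.single_eq_of_ne (hb.trans_lt hkm).ne', add_zero]

theorem multiIndex_le_length (hw : IsHallEnumeration s w) (i m : Fin n) :
    multiIndex w (w i) m < (w i).length := by
  induction i using hw.hall_induction with
  | of i q h => rw [h]; exact Nat.one_pos
  | mul i a b h iha _ =>
    have := (w b).length_pos
    rw [h, multiIndex_mul hw.injective, Finsupp.add_apply, freeMagma_length_mul,
      Finsupp.single_apply]
    split_ifs <;> omega

theorem le_of_extends (hw : IsHallEnumeration s w) {i l : Fin n} (h : Extends (w i) (w l)) :
    i ≤ l := by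
  rcases h.eq_or_length_lt with h | h
  · exact (hw.injective h).ge
  · exact (hw.lt_of_length_lt _ _ h).le

theorem multiIndex_le_of_extends (hw : IsHallEnumeration s w) {i l : Fin n}
    (h : Extends (w i) (w l)) : multiIndex w (w i) ≤ multiIndex w (w l) := by
  induction l using hw.hall_induction with
  | of l q hl =>
    rw [hl] at h ⊢
    rw [(extends_of _ q).1 h]
  | mul l a b hl iha _ =>
    rcases (extends_mul (w i) (w a) (w b)).1 (hl ▸ h) with h' | h'
    · rw [hl, h']
    · rw [hl, multiIndex_mul hw.injective]
      exact (iha h').trans le_self_add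

/-- A proper extension of a Hall element `a` extends a Hall element `[a, j]`. -/
theorem exists_mul_of_extends (hw : IsHallEnumeration s w) {a l : Fin n}
    (h : Extends (w a) (w l)) (hne : l ≠ a) :
    ∃ i j, w i = w a * w j ∧ Extends (w i) (w l) := by
  induction l using hw.hall_induction with
  | of l q hl => exact absurd (hw.injective (hl.trans ((extends_of _ q).1 (hl ▸ h)))) hne
  | mul l c d hl ihc _ =>
    rcases (extends_mul (w a) (w c) (w d)).1 (hl ▸ h) with h' | h'
    · exact absurd (hw.injective (hl.trans h')) hne
    · by_cases hca : c = a
      · subst hca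
        exact ⟨l, d, hl, Extends.refl _⟩
      · obtain ⟨i, j, hij, hi⟩ := ihc h' hca
        refine ⟨i, j, hij, ?_⟩
        rw [hl]
        exact Or.inr hi

/-- Once `j` has been used as a right factor, every later factor is at least `j`, so a smaller `b`
can occur only inside `a`. The clause on the last factor of `l` is what the induction propagates. -/
theorem multiIndex_eq_of_extends (hw : IsHallEnumeration s w) {i a j l b : Fin n}
    (h : Extends (w i) (w l)) (hi : w i = w a * w j) (hb : b < j) :
    multiIndex w (w l) b = multiIndex w (w a) b ∧ ∃ c d, w l = w c * w d ∧ j ≤ d := by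
  induction l using hw.hall_induction with
  | of l q hl =>
    rw [hl, extends_of, hi] at h
    exact absurd h (freeMagma_of_ne_mul _ _ _)
  | mul l c d hl ihc _ =>
    have key : j ≤ d ∧ multiIndex w (w c) b = multiIndex w (w a) b := by
      rcases (extends_mul (w i) (w c) (w d)).1 (hl ▸ h) with h' | h'
      · obtain ⟨h1, h2⟩ := freeMagma_mul_inj.1 (h'.trans hi)
        exact ⟨(hw.injective h2).ge, by rw [h1]⟩
      · obtain ⟨h1, e, f, hef, hjf⟩ := ihc h'
        exact ⟨hjf.trans ((hw.mul_factors hl).2.1 e f hef), h1⟩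
    refine ⟨?_, c, d, hl, key.1⟩
    rw [hl, multiIndex_mul hw.injective, Finsupp.add_apply, key.2,
      Finsupp.single_eq_of_ne (hb.trans_le key.1).ne, add_zero]

end IsHallEnumeration

end Hall

/-! ### Restriction to coordinate subspaces -/

section Restriction

variable {n : ℕ}

open MvPolynomial

theorem prod_factorial_add_single (α : Fin n →₀ ℕ) (b : Fin n) :
    (∏ j, (((α + Finsupp.single b 1 : Fin n →₀ ℕ) j).factorial : ℝ)) =
      (α b + 1) * ∏ j, ((α j).factorial : ℝ) := by
  classical
  rw [← Finset.mul_prod_erase _ _ (Finset.mem_univ b),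
    ← Finset.mul_prod_erase _ (fun j => ((α j).factorial : ℝ)) (Finset.mem_univ b), ← mul_assoc]
  congr 1
  · simp [Nat.factorial_succ]
  · refine Finset.prod_congr rfl fun j hj => ?_
    rw [Finsupp.add_apply, Finsupp.single_eq_of_ne (Finset.ne_of_mem_erase hj), add_zero]

theorem signedInvFactorial_zero : signedInvFactorial (0 : Fin n →₀ ℕ) = 1 := by
  simp [signedInvFactorial]

/-- This recursion drives both the derivative formula for the Hall fields and the elimination step.
-/
theorem signedInvFactorial_add_single (α : Fin n →₀ ℕ) (b : Fin n) :
    signedInvFactorial (α + Finsupp.single b 1) * (α b + 1) = -signedInvFactorial α := by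
  have hsum : ∑ j, (α + Finsupp.single b 1 : Fin n →₀ ℕ) j = ∑ j, α j + 1 := by
    simp only [Finsupp.add_apply, Finset.sum_add_distrib]
    congr 1
    rw [Finset.sum_eq_single b] <;> simp +contextual [Finsupp.single_eq_of_ne]
  have h1 : (α b + 1 : ℝ) ≠ 0 := by positivity
  have h2 : (∏ j, ((α j).factorial : ℝ)) ≠ 0 :=
    Finset.prod_ne_zero_iff.2 fun j _ => by positivity
  rw [signedInvFactorial, signedInvFactorial, prod_factorial_add_single, hsum, pow_succ]
  field_simp

/-- Restriction of polynomials to the coordinate subspace `{x | xⱼ = 0 for j < k}`. -/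
def restrictFrom (k : Fin n) : MvPolynomial (Fin n) ℝ →ₐ[ℝ] MvPolynomial (Fin n) ℝ :=
  aeval fun j => if j < k then 0 else X j

theorem restrictFrom_X (k j : Fin n) :
    restrictFrom k (X j) = if j < k then 0 else X j := by
  simp [restrictFrom]

theorem restrictFrom_monomial_of_lt {k j : Fin n} (hj : j < k) {α : Fin n →₀ ℕ} (hα : α j ≠ 0)
    (c : ℝ) : restrictFrom k (monomial α c) = 0 := by
  rw [restrictFrom, aeval_monomial, Finsupp.prod,
    Finset.prod_eq_zero (Finsupp.mem_support_iff.2 hα), mul_zero]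
  rw [if_pos hj, zero_pow hα]

theorem restrictFrom_monomial_of_forall {k : Fin n} {α : Fin n →₀ ℕ} (hα : ∀ j < k, α j = 0)
    (c : ℝ) : restrictFrom k (monomial α c) = monomial α c := by
  rw [restrictFrom, aeval_monomial, monomial_eq, algebraMap_eq]
  congr 1
  refine Finset.prod_congr rfl fun j hj => ?_
  simp only [if_neg fun h => Finsupp.mem_support_iff.1 hj (hα j h)]

theorem restrictFrom_restrictFrom {b k : Fin n} (h : b ≤ k) (p : MvPolynomial (Fin n) ℝ) :
    restrictFrom k (restrictFrom b p) = restrictFrom k p := by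
  have : (restrictFrom k).comp (restrictFrom b) = restrictFrom k := by
    ext1 j
    rw [AlgHom.comp_apply, restrictFrom_X, restrictFrom_X]
    split_ifs with h1 h2 h2
    · rw [map_zero]
    · exact absurd (h1.trans_le h) h2
    · rw [restrictFrom_X, if_pos h2]
    · rw [restrictFrom_X, if_neg h2]
  exact DFunLike.congr_fun this p

/-- A vector field tangent to the coordinate subspace restricts to it. -/
theorem restrictFrom_derivation {k : Fin n} (D : PolyField n)
    (hD : ∀ l < k, restrictFrom k (D (X l)) = 0) (p : MvPolynomial (Fin n) ℝ) :
    restrictFrom k (D p) =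
      mkDerivation ℝ (fun l => restrictFrom k (D (X l))) (restrictFrom k p) := by
  induction p using MvPolynomial.induction_on with
  | C a =>
    have h : (C a : MvPolynomial (Fin n) ℝ) = algebraMap ℝ _ a := rfl
    rw [h, Derivation.map_algebraMap, map_zero, AlgHom.commutes, Derivation.map_algebraMap]
  | add p q hp hq => simp only [map_add, hp, hq]
  | mul_X p l hp =>
    rw [Derivation.leibniz, map_mul, Derivation.leibniz, ← hp, map_add, smul_eq_mul, smul_eq_mul,
      smul_eq_mul, smul_eq_mul, map_mul, map_mul, restrictFrom_X]
    congr 2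
    split_ifs with h
    · rw [hD l h, map_zero]
    · rw [mkDerivation_X]

end Restriction

/-! ### Coefficients of the Hall fields and linear independence -/

section HallFields

open MvPolynomial

variable {r n s : ℕ} {w : Fin n → FreeMagma (Fin r)}

/-- The coefficient `(-1)^{|J|} / J! x^J` with `J = I(y) - I(x)` if `y` extends `x`, and `0`
otherwise. -/
def extCoeff (w : Fin n → FreeMagma (Fin r)) (x y : FreeMagma (Fin r)) :
    MvPolynomial (Fin n) ℝ := by
  classical
  exact if Extends x y then monomial (multiIndex w y - multiIndex w x)
    (signedInvFactorial (multiIndex w y - multiIndex w x)) else 0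

theorem extCoeff_of_extends {x y : FreeMagma (Fin r)} (h : Extends x y) :
    extCoeff w x y = monomial (multiIndex w y - multiIndex w x)
      (signedInvFactorial (multiIndex w y - multiIndex w x)) := if_pos h

theorem extCoeff_of_not_extends {x y : FreeMagma (Fin r)} (h : ¬ Extends x y) :
    extCoeff w x y = 0 := if_neg h

theorem extCoeff_self (x : FreeMagma (Fin r)) : extCoeff w x x = 1 := by
  rw [extCoeff_of_extends (Extends.refl x), tsub_self, signedInvFactorial_zero]
  rfl

theorem generatorField_X (q : Fin r) (l : Fin n) :
    generatorField w q (X l) = extCoeff w (FreeMagma.of q) (w l) := by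
  rw [generatorField, mkDerivation_X]
  split_ifs with h
  · rw [extCoeff_of_extends ((extends_of_iff_root q _).2 h), multiIndex_of, tsub_zero]
  · rw [extCoeff_of_not_extends fun h' => h ((extends_of_iff_root q _).1 h')]

theorem evalField_mul (x y : FreeMagma (Fin r)) :
    evalField w (x * y) = ⁅evalField w x, evalField w y⁆ := rfl

namespace IsHallEnumeration

/-- A proper extension of `b` begins with some [b, j], where j < b; its coefficient therefore
contains x_j, which vanishes on the subspace. -/
theorem restrictFrom_extCoeff_self (hw : IsHallEnumeration s w) (b l : Fin n) :
    restrictFrom b (extCoeff w (w b) (w l)) = if l = b then 1 else 0 := by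
  split_ifs with h
  · rw [h, extCoeff_self, map_one]
  · by_cases he : Extends (w b) (w l)
    · obtain ⟨i, j, hij, hi⟩ := hw.exists_mul_of_extends he h
      rw [extCoeff_of_extends he]
      refine restrictFrom_monomial_of_lt (hw.mul_factors hij).1 ?_ _
      have := hw.multiIndex_le_of_extends hi j
      rw [hij, multiIndex_mul hw.injective, Finsupp.add_apply, Finsupp.single_eq_same] at this
      rw [Finsupp.tsub_apply]
      omega
    · rw [extCoeff_of_not_extends he, map_zero]

/-- This is the effect of bracketing with X_b, which restricts to ∂/∂x_b on the subspace. -/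
theorem pderiv_restrictFrom_extCoeff (hw : IsHallEnumeration s w) {i a b : Fin n}
    (hi : w i = w a * w b) (l : Fin n) :
    pderiv b (restrictFrom b (extCoeff w (w a) (w l))) =
      -restrictFrom b (extCoeff w (w i) (w l)) := by
  have hia : ∀ {y}, Extends (w i) y → Extends (w a) y := fun h =>
    Extends.of_mul_left (z := w b) (hi ▸ h)
  by_cases hl : Extends (w a) (w l)
  swap
  · rw [extCoeff_of_not_extends hl, extCoeff_of_not_extends fun h => hl (hia h), map_zero,
      map_zero, neg_zero]
  by_cases hla : l = a
  · subst hla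
    have : ¬ Extends (w i) (w l) := fun h =>
      (hw.le_of_extends h).not_gt (hw.mul_factors hi).2.2.1
    rw [extCoeff_self, extCoeff_of_not_extends this, map_one, map_zero, neg_zero]
    exact pderiv_one
  obtain ⟨c, j, hc, hcl⟩ := hw.exists_mul_of_extends hl hla
  -- Here `j` is the first factor after `a` on the way to `l`. If j < b, the factor x_j restricts to
  -- 0. If j = b, the monomial is differentiated. If j > b, all later factors exceed `b`, so x_b
  -- does not occur.
  rcases lt_trichotomy j b with hjb | rfl | hbj
  · have hn : ¬ Extends (w i) (w l) := by
      intro h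
      have h1 := hw.multiIndex_eq_of_extends h hi hjb
      have h2 := hw.multiIndex_le_of_extends hcl j
      rw [hc, multiIndex_mul hw.injective, Finsupp.add_apply, Finsupp.single_eq_same] at h2
      omega
    have h2 := hw.multiIndex_le_of_extends hcl j
    rw [hc, multiIndex_mul hw.injective, Finsupp.add_apply, Finsupp.single_eq_same] at h2
    rw [extCoeff_of_not_extends hn, map_zero, neg_zero, extCoeff_of_extends hl,
      restrictFrom_monomial_of_lt hjb, map_zero]
    rw [Finsupp.tsub_apply]
    omega
  · obtain rfl : c = i := hw.injective (hc.trans hi.symm)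
    set α := multiIndex w (w l) - multiIndex w (w c) with hα
    have hJ : multiIndex w (w l) - multiIndex w (w a) = α + Finsupp.single j 1 := by
      have h2 := hw.multiIndex_le_of_extends hcl
      rw [hα, ← tsub_tsub_assoc h2]
      · congr 1
        rw [hc, multiIndex_mul hw.injective, add_tsub_cancel_right]
      · rw [hc, multiIndex_mul hw.injective]
        exact le_add_self
    rw [extCoeff_of_extends hl, extCoeff_of_extends hcl, ← hα, hJ]
    by_cases h : ∃ m < j, α m ≠ 0
    · obtain ⟨m, hm, hαm⟩ := h
      rw [restrictFrom_monomial_of_lt hm hαm, restrictFrom_monomial_of_lt hm, map_zero, neg_zero]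
      rw [Finsupp.add_apply]
      omega
    · push Not at h
      rw [restrictFrom_monomial_of_forall h, restrictFrom_monomial_of_forall, pderiv_monomial,
        add_tsub_cancel_right, Finsupp.add_apply, Finsupp.single_eq_same, Nat.cast_add,
        Nat.cast_one, signedInvFactorial_add_single, map_neg]
      intro m hm
      rw [Finsupp.add_apply, h m hm, Finsupp.single_eq_of_ne hm.ne, add_zero]
  · have h1 := (hw.multiIndex_eq_of_extends hcl hc hbj).1
    have hn : ¬ Extends (w i) (w l) := by
      intro h
      have h2 := hw.multiIndex_le_of_extends h b
      rw [hi, multiIndex_mul hw.injective, Finsupp.add_apply, Finsupp.single_eq_same] at h2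
      omega
    rw [extCoeff_of_not_extends hn, map_zero, neg_zero, extCoeff_of_extends hl]
    set α := multiIndex w (w l) - multiIndex w (w a) with hα
    have hαb : α b = 0 := by rw [hα, Finsupp.tsub_apply, h1, tsub_self]
    by_cases h : ∃ m < b, α m ≠ 0
    · obtain ⟨m, hm, hαm⟩ := h
      rw [restrictFrom_monomial_of_lt hm hαm, map_zero]
    · push Not at h
      rw [restrictFrom_monomial_of_forall h, pderiv_monomial, hαb, Nat.cast_zero, mul_zero,
        map_zero]

/-- The coefficients of the Hall vector field `X_i` on the coordinate subspace
`{x | xⱼ = 0 for j < k}`. -/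
theorem restrictFrom_hallField (hw : IsHallEnumeration s w) (i : Fin n) {k : Fin n}
    (hk : FactorLE w i k) (l : Fin n) :
    restrictFrom k (hallField w i (X l)) = restrictFrom k (extCoeff w (w i) (w l)) := by
  induction i using hw.hall_induction generalizing k l with
  | of i q h =>
    rw [hallField, h]
    exact congrArg _ (generatorField_X q l)
  | mul i a b h iha ihb =>
    have hb : ∀ l, restrictFrom b (hallField w b (X l)) = if l = b then 1 else 0 := fun l =>
      (ihb (hw.factorLE_self b) l).trans (hw.restrictFrom_extCoeff_self b l)
    have ha := iha (hw.mul_factors h).2.1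
    have hta : ∀ l < b, restrictFrom b (hallField w a (X l)) = 0 := by
      intro l hl
      rw [ha, extCoeff_of_not_extends, map_zero]
      intro h'
      exact ((hw.le_of_extends h').trans_lt hl).not_gt (hw.mul_factors h).1
    have htb : ∀ l < b, restrictFrom b (hallField w b (X l)) = 0 := by
      intro l hl
      rw [hb, if_neg hl.ne]
    -- Since b ≤ k, it suffices to compare the coefficients on the larger subspace belonging to `b`,
    -- where X_b is ∂/∂x_b and X_a is tangent.
    rw [← restrictFrom_restrictFrom (hk a b h) (hallField w i (X l)),
      ← restrictFrom_restrictFrom (hk a b h) (extCoeff _ _ _), hallField, h, evalField_mul, ← h]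
    congr 1
    rw [Derivation.commutator_apply, map_sub]
    change restrictFrom b (hallField w a (hallField w b (X l))) -
      restrictFrom b (hallField w b (hallField w a (X l))) = _
    have h1 : (mkDerivation ℝ fun l => restrictFrom b (hallField w b (X l))) = pderiv b := by
      refine derivation_ext fun m => ?_
      rw [mkDerivation_X, hb, pderiv_X, Pi.single_apply]
    have h2 : ∀ D : PolyField n, D (if l = b then 1 else 0) = 0 := by
      intro D
      split_ifs
      · exact D.map_one_eq_zero
      · exact map_zero D
    -- The term X_a(X_b x_l) vanishes because X_b has constant coefficients on the subspace; only
    -- the x_b-derivative of the coefficient of X_a survives.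
    rw [restrictFrom_derivation _ hta, hb, h2, restrictFrom_derivation _ htb, h1, zero_sub, ha,
      hw.pderiv_restrictFrom_extCoeff h, neg_neg]

/-- At the origin `X_i` is `∂/∂x_i`. -/
theorem constantCoeff_hallField (hw : IsHallEnumeration s w) (i l : Fin n) :
    constantCoeff (hallField w i (X l)) = if l = i then 1 else 0 := by
  have h0 : ∀ p : MvPolynomial (Fin n) ℝ, constantCoeff (restrictFrom i p) = constantCoeff p := by
    intro p
    induction p using MvPolynomial.induction_on with
    | C a =>
      have h : (C a : MvPolynomial (Fin n) ℝ) = algebraMap ℝ _ a := rfl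
      rw [h, AlgHom.commutes]
    | add p q hp hq => rw [map_add, map_add, map_add, hp, hq]
    | mul_X p j hp =>
      rw [map_mul, map_mul, map_mul, restrictFrom_X, constantCoeff_X]
      split_ifs <;> simp
  rw [← h0, hw.restrictFrom_hallField i (hw.factorLE_self i), hw.restrictFrom_extCoeff_self]
  split_ifs <;> simp

theorem linearIndependent_hallField (hw : IsHallEnumeration s w) :
    LinearIndependent ℝ (hallField w) := by
  rw [Fintype.linearIndependent_iff]
  intro g hg i
  have h := congrArg (fun D : PolyField n => constantCoeff (D (X i))) hg
  have hsum : ∀ (t : Finset (Fin n)) (p : MvPolynomial (Fin n) ℝ),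
      (∑ j ∈ t, g j • hallField w j) p = ∑ j ∈ t, g j • hallField w j p := by
    intro t p
    induction t using Finset.cons_induction with
    | empty => rfl
    | cons a t ha ih =>
      rw [Finset.sum_cons, Finset.sum_cons, Derivation.add_apply, ih, Derivation.smul_apply]
  simpa [hsum, hw.constantCoeff_hallField, smul_eq_C_mul] using h

end IsHallEnumeration

end HallFields

/-! ### Hall's rewriting process: Hall elements span -/

section Spanning

variable {r n s : ℕ} {w : Fin n → FreeMagma (Fin r)} {L : Type*} [LieRing L] [LieAlgebra ℝ L]

/-- Evaluation of a formal bracket in a Lie algebra. -/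
def evalLie (g : Fin r → L) : FreeMagma (Fin r) → L
  | .of q => g q
  | .mul x y => ⁅evalLie g x, evalLie g y⁆

omit [LieAlgebra ℝ L] in
theorem evalLie_mul (g : Fin r → L) (x y : FreeMagma (Fin r)) :
    evalLie g (x * y) = ⁅evalLie g x, evalLie g y⁆ := rfl

theorem map_evalLie {L' : Type*} [LieRing L'] [LieAlgebra ℝ L'] (f : L →ₗ⁅ℝ⁆ L') (g : Fin r → L)
    (x : FreeMagma (Fin r)) : f (evalLie g x) = evalLie (fun q => f (g q)) x := by
  induction x with
  | ih1 q => rfl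
  | ih2 x y hx hy => rw [evalLie_mul, evalLie_mul, LieHom.map_lie, hx, hy]

theorem lie_mem_of_mem_span {S T : Set L} {V : Submodule ℝ L}
    (h : ∀ x ∈ S, ∀ y ∈ T, ⁅x, y⁆ ∈ V) {x y : L} (hx : x ∈ Submodule.span ℝ S)
    (hy : y ∈ Submodule.span ℝ T) : ⁅x, y⁆ ∈ V := by
  induction hx using Submodule.span_induction with
  | mem x hx =>
    induction hy using Submodule.span_induction with
    | mem y hy => exact h x hx y hy
    | zero => rw [lie_zero]; exact V.zero_mem
    | add y z _ _ hy hz => rw [lie_add]; exact V.add_mem hy hz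
    | smul a y _ hy => rw [lie_smul]; exact V.smul_mem a hy
  | zero => rw [zero_lie]; exact V.zero_mem
  | add x z _ _ hx hz => rw [add_lie]; exact V.add_mem hx hz
  | smul a x _ hx => rw [smul_lie]; exact V.smul_mem a hx

theorem mem_span_evalLie_of_mem_lieSpan (g : Fin r → L) {x : L}
    (hx : x ∈ LieSubalgebra.lieSpan ℝ L (Set.range g)) :
    x ∈ Submodule.span ℝ (Set.range (evalLie g)) := by
  induction hx using LieSubalgebra.lieSpan_induction with
  | mem x hx =>
    obtain ⟨q, rfl⟩ := hx
    exact Submodule.subset_span ⟨FreeMagma.of q, rfl⟩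
  | zero => exact Submodule.zero_mem _
  | add x y _ _ hx hy => exact Submodule.add_mem _ hx hy
  | smul a x _ hx => exact Submodule.smul_mem _ a hx
  | lie x y _ _ hx hy =>
    refine lie_mem_of_mem_span ?_ hx hy
    rintro _ ⟨x, rfl⟩ _ ⟨y, rfl⟩
    exact Submodule.subset_span ⟨x * y, rfl⟩

/-- The universal property gives a map into the generated subalgebra; composed with the inclusion it
fixes the generators, hence is the identity. -/
theorem lieSpan_range_freeLieAlgebra_of (X : Type*) :
    LieSubalgebra.lieSpan ℝ (FreeLieAlgebra ℝ X) (Set.range (FreeLieAlgebra.of ℝ)) = ⊤ := by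
  set S := LieSubalgebra.lieSpan ℝ (FreeLieAlgebra ℝ X) (Set.range (FreeLieAlgebra.of ℝ))
  let F : FreeLieAlgebra ℝ X →ₗ⁅ℝ⁆ S := FreeLieAlgebra.lift ℝ fun x =>
    ⟨FreeLieAlgebra.of ℝ x, LieSubalgebra.subset_lieSpan ⟨x, rfl⟩⟩
  have h : S.incl.comp F = LieHom.id := by
    ext x
    simp [F]
  rw [eq_top_iff]
  intro y _
  have hy : S.incl (F y) = y := LieHom.congr_fun h y
  rw [← hy]
  exact (F y).2

/-- The span of the values of the Hall elements of degree `d`. -/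
def hallSpan (w : Fin n → FreeMagma (Fin r)) (g : Fin r → L) (d : ℕ) : Submodule ℝ L :=
  Submodule.span ℝ {x | ∃ i, (w i).length = d ∧ evalLie g (w i) = x}

theorem evalLie_mem_hallSpan (w : Fin n → FreeMagma (Fin r)) (g : Fin r → L) (i : Fin n) :
    evalLie g (w i) ∈ hallSpan w g (w i).length :=
  Submodule.subset_span ⟨i, rfl, rfl⟩

namespace IsHallEnumeration

/-- Induction on the total degree and, inside it, downward on the smaller factor `j`. If [i, j] is
not a Hall element, then i = [h, k] with k > j, and the Jacobi identity gives [h, [k, j]] − [k, [h,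
j]], whose outer brackets can be rewritten with both factors above `j`. -/
theorem lie_mem_hallSpan (hw : IsHallEnumeration s w) (g : Fin r → L) {d : ℕ} (hd : d ≤ s)
    (i j : Fin n) (hij : (w i).length + (w j).length = d) :
    ⁅evalLie g (w i), evalLie g (w j)⁆ ∈ hallSpan w g d := by
  induction d using Nat.strong_induction_on generalizing i j with
  | _ d ihd =>
  have lower : ∀ i j, (w i).length + (w j).length < d →
      ⁅evalLie g (w i), evalLie g (w j)⁆ ∈ hallSpan w g ((w i).length + (w j).length) :=
    fun i j h => ihd _ h (h.le.trans hd) i j rfl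
  have symm : ∀ i j, ⁅evalLie g (w i), evalLie g (w j)⁆ ∈ hallSpan w g d →
      ⁅evalLie g (w j), evalLie g (w i)⁆ ∈ hallSpan w g d := by
    intro i j h
    rw [← lie_skew]
    exact neg_mem h
  have main : ∀ j i : Fin n, j < i → (w i).length + (w j).length = d →
      ⁅evalLie g (w i), evalLie g (w j)⁆ ∈ hallSpan w g d := by
    intro j
    induction j using WellFoundedGT.induction with
    | ind j ihj =>
    intro i hji hij
    have either : ∀ a b : Fin n, j < a → j < b → (w a).length + (w b).length = d →
        ⁅evalLie g (w a), evalLie g (w b)⁆ ∈ hallSpan w g d := by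
      intro a b ha hb hab
      rcases lt_trichotomy a b with h | rfl | h
      · exact symm _ _ (ihj a ha b h (by omega))
      · rw [lie_self]; exact Submodule.zero_mem _
      · exact ihj b hb a h hab
    by_cases hf : FactorLE w i j
    · obtain ⟨l, hl⟩ := hw.exists_mul hji hf (hij.trans_le hd)
      rw [← evalLie_mul, ← hl, ← hij, ← freeMagma_length_mul, ← hl]
      exact evalLie_mem_hallSpan w g l
    · simp only [FactorLE] at hf
      push Not at hf
      obtain ⟨h, k, hik, hjk⟩ := hf
      have hkh := (hw.mul_factors hik).1
      have hlen := congrArg FreeMagma.length hik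
      rw [freeMagma_length_mul] at hlen
      have h1 := (w h).length_pos
      have h2 := (w k).length_pos
      have nested : ∀ a b : Fin n, j < a → (w a).length + (w b).length + (w j).length = d →
          ⁅evalLie g (w a), ⁅evalLie g (w b), evalLie g (w j)⁆⁆ ∈ hallSpan w g d := by
        intro a b ha hab
        have h3 := (w a).length_pos
        have h4 := (w b).length_pos
        refine lie_mem_of_mem_span ?_ (Submodule.mem_span_singleton_self _)
          (lower b j (by omega))
        rintro _ rfl _ ⟨u, hu, rfl⟩
        -- A Hall element `u` in the expansion of [b, j] has larger degree than `j`, hence u > j.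
        exact either a u ha (hw.lt_of_length_lt _ _ (by omega)) (by omega)
      rw [hik, evalLie_mul, lie_lie]
      exact Submodule.sub_mem _ (nested h k (hjk.trans hkh) (by omega))
        (nested k h hjk (by omega))
  rcases lt_trichotomy i j with h | rfl | h
  · exact symm _ _ (main i j h (by omega))
  · rw [lie_self]; exact Submodule.zero_mem _
  · exact main j i h hij

theorem evalLie_mem_hallSpan_length (hw : IsHallEnumeration s w) (g : Fin r → L)
    (x : FreeMagma (Fin r)) (hx : x.length ≤ s) : evalLie g x ∈ hallSpan w g x.length := by
  induction x with
  | ih1 q =>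
    have := evalLie_mem_hallSpan w g (Fin.castLE hw.rank_le q)
    rwa [hw.gen q] at this
  | ih2 x y ihx ihy =>
    rw [freeMagma_length_mul] at hx
    refine lie_mem_of_mem_span ?_ (ihx (by omega)) (ihy (by omega))
    rintro _ ⟨i, hi, rfl⟩ _ ⟨j, hj, rfl⟩
    exact hw.lie_mem_hallSpan g hx i j (by rw [hi, hj])

/-- If all brackets of degree larger than `s` vanish, the Hall elements span. -/
theorem lieSpan_le_span (hw : IsHallEnumeration s w) (g : Fin r → L)
    (hg : ∀ x : FreeMagma (Fin r), s < x.length → evalLie g x = 0) {x : L}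
    (hx : x ∈ LieSubalgebra.lieSpan ℝ L (Set.range g)) :
    x ∈ Submodule.span ℝ (Set.range fun i => evalLie g (w i)) := by
  refine Submodule.span_le.2 ?_ (mem_span_evalLie_of_mem_lieSpan g hx)
  rintro _ ⟨y, rfl⟩
  rcases le_or_gt y.length s with h | h
  · refine Submodule.span_mono ?_ (hw.evalLie_mem_hallSpan_length g y h)
    rintro _ ⟨i, _, rfl⟩
    exact ⟨i, rfl⟩
  · rw [hg y h]
    exact Submodule.zero_mem _

end IsHallEnumeration

end Spanning

/-! ### Brackets and the lower central series -/

section LowerCentralSeries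

open LieModule

variable {r s : ℕ} {L : Type*} [LieRing L] [LieAlgebra ℝ L]

/-- An additive property stable under brackets passes along the lower central series. -/
theorem lowerCentralSeries_succ_induction {k : ℕ} {V : Submodule ℝ L}
    (h : ∀ x : L, ∀ y ∈ lowerCentralSeries ℝ L L k, ⁅x, y⁆ ∈ V) {z : L}
    (hz : z ∈ lowerCentralSeries ℝ L L (k + 1)) : z ∈ V := by
  rw [lowerCentralSeries_succ, ← LieSubmodule.mem_toSubmodule,
    LieSubmodule.lieIdeal_oper_eq_linear_span'] at hz
  refine Submodule.span_le.2 ?_ hz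
  rintro _ ⟨x, _, y, hy, rfl⟩
  exact h x y hy

theorem lie_mem_lowerCentralSeries_succ {k : ℕ} (x : L) {y : L}
    (hy : y ∈ lowerCentralSeries ℝ L L k) : ⁅x, y⁆ ∈ lowerCentralSeries ℝ L L (k + 1) := by
  rw [lowerCentralSeries_succ]
  exact LieSubmodule.lie_mem_lie (LieSubmodule.mem_top x) hy

/-- The extra 1 comes from numbering the series from 0. The induction on `a` moves one bracket
across by the Jacobi identity. -/
theorem lie_mem_lowerCentralSeries_add {a b : ℕ} {x y : L}
    (hx : x ∈ lowerCentralSeries ℝ L L a) (hy : y ∈ lowerCentralSeries ℝ L L b) :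
    ⁅x, y⁆ ∈ lowerCentralSeries ℝ L L (a + b + 1) := by
  induction a generalizing b x y with
  | zero =>
    rw [zero_add]
    exact lie_mem_lowerCentralSeries_succ x hy
  | succ a ih =>
    let V : Submodule ℝ L := (lowerCentralSeries ℝ L L (a + 1 + b + 1)).toSubmodule.comap
      (LieAlgebra.ad ℝ L y : L →ₗ[ℝ] L)
    have hV : ∀ z, z ∈ V ↔ ⁅y, z⁆ ∈ lowerCentralSeries ℝ L L (a + 1 + b + 1) := fun _ => Iff.rfl
    have hxV : x ∈ V := by
      refine lowerCentralSeries_succ_induction (fun u v hv => ?_) hx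
      rw [hV, ← lie_skew, neg_mem_iff, lie_lie]
      refine sub_mem ?_ ?_
      · have := lie_mem_lowerCentralSeries_succ u (ih hv hy)
        rwa [show a + b + 1 + 1 = a + 1 + b + 1 by omega] at this
      · have := ih hv (lie_mem_lowerCentralSeries_succ u hy)
        rwa [show a + (b + 1) + 1 = a + 1 + b + 1 by omega] at this
    rw [← lie_skew, neg_mem_iff]
    exact (hV x).1 hxV

theorem evalLie_mem_lowerCentralSeries (g : Fin r → L) (x : FreeMagma (Fin r)) {k : ℕ}
    (hk : k < x.length) : evalLie g x ∈ lowerCentralSeries ℝ L L k := by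
  induction x generalizing k with
  | ih1 q =>
    obtain rfl : k = 0 := Nat.lt_one_iff.1 hk
    exact LieSubmodule.mem_top _
  | ih2 x y ihx ihy =>
    have hx := x.length_pos
    have hy := y.length_pos
    rw [freeMagma_length_mul] at hk
    have h := lie_mem_lowerCentralSeries_add (ihx (k := x.length - 1) (by omega))
      (ihy (k := y.length - 1) (by omega))
    exact antitone_lowerCentralSeries ℝ L L (by omega) h

end LowerCentralSeries

/-! ### Weight filtration and nilpotency -/

section Filtration

open MvPolynomial

variable {r n s : ℕ} {w : Fin n → FreeMagma (Fin r)}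

/-- The weight of a monomial, where `x_l` has the degree of the `l`-th Hall element. -/
def hallWeight (w : Fin n → FreeMagma (Fin r)) : (Fin n →₀ ℕ) →+ ℕ :=
  Finsupp.weight fun l => (w l).length

theorem hallWeight_single (l : Fin n) : hallWeight w (Finsupp.single l 1) = (w l).length := by
  simp [hallWeight, Finsupp.weight_single]

/-- Polynomials of weight at most `e`. -/
def weightLE (w : Fin n → FreeMagma (Fin r)) (e : ℤ) : Submodule ℝ (MvPolynomial (Fin n) ℝ) :=
  restrictSupport ℝ {α | (hallWeight w α : ℤ) ≤ e}

theorem weightLE_mono {d e : ℤ} (h : d ≤ e) : weightLE w d ≤ weightLE w e :=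
  restrictSupport_mono _ fun _ hα => le_trans hα h

theorem monomial_mem_weightLE {α : Fin n →₀ ℕ} {e : ℤ} (h : (hallWeight w α : ℤ) ≤ e) (c : ℝ) :
    monomial α c ∈ weightLE w e := (monomial_mem_restrictSupport ℝ).2 (Or.inl h)

theorem mul_mem_weightLE {d e : ℤ} {p q : MvPolynomial (Fin n) ℝ} (hp : p ∈ weightLE w d)
    (hq : q ∈ weightLE w e) : p * q ∈ weightLE w (d + e) := by
  have h := Submodule.mul_mem_mul hp hq
  rw [weightLE, weightLE, ← restrictSupport_add] at h
  refine restrictSupport_mono _ ?_ h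
  rintro _ ⟨α, hα, β, hβ, rfl⟩
  simp only [Set.mem_ofPred_eq, map_add, Nat.cast_add] at hα hβ ⊢
  exact add_le_add hα hβ

/-- Integer levels let weights be lowered without truncation; this vanishing below level 0 is the
source of nilpotency. -/
theorem eq_zero_of_mem_weightLE {e : ℤ} (he : e < 0) {p : MvPolynomial (Fin n) ℝ}
    (hp : p ∈ weightLE w e) : p = 0 := by
  rw [← support_eq_empty, Finset.eq_empty_iff_forall_notMem]
  intro α hα
  have : (hallWeight w α : ℤ) ≤ e := (mem_restrictSupport_iff ℝ).1 hp hα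
  omega

/-- Vector fields that lower the weight by at least `k`. -/
def lowering (w : Fin n → FreeMagma (Fin r)) (k : ℕ) : Submodule ℝ (PolyField n) where
  carrier := {D | ∀ e, ∀ p ∈ weightLE w e, D p ∈ weightLE w (e - k)}
  add_mem' hD hE e p hp := Submodule.add_mem _ (hD e p hp) (hE e p hp)
  zero_mem' _ _ _ := Submodule.zero_mem _
  smul_mem' a _ hD e p hp := Submodule.smul_mem _ a (hD e p hp)

theorem lowering_anti {j k : ℕ} (h : j ≤ k) : lowering w k ≤ lowering w j :=
  fun _ hD e p hp => weightLE_mono (by omega) (hD e p hp)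

theorem lie_mem_lowering {j k : ℕ} {D E : PolyField n} (hD : D ∈ lowering w j)
    (hE : E ∈ lowering w k) : ⁅D, E⁆ ∈ lowering w (j + k) := by
  intro e p hp
  rw [Derivation.commutator_apply]
  have h1 := hD _ _ (hE e p hp)
  have h2 := hE _ _ (hD e p hp)
  rw [show e - k - j = e - ((j + k : ℕ) : ℤ) by push_cast; ring] at h1
  rw [show e - j - k = e - ((j + k : ℕ) : ℤ) by push_cast; ring] at h2
  exact Submodule.sub_mem _ h1 h2

theorem mkDerivation_mem_lowering {k : ℕ} {f : Fin n → MvPolynomial (Fin n) ℝ}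
    (hf : ∀ l, f l ∈ weightLE w ((w l).length - k)) : mkDerivation ℝ f ∈ lowering w k := by
  intro e p hp
  rw [weightLE, restrictSupport_eq_span] at hp
  induction hp using Submodule.span_induction with
  | mem p hp =>
    obtain ⟨α, hα, rfl⟩ := hp
    rw [mkDerivation_monomial, one_smul]
    refine Submodule.sum_mem _ fun l hl => ?_
    have hle : Finsupp.single l 1 ≤ α := by
      rw [Finsupp.single_le_iff]
      exact Nat.one_le_iff_ne_zero.2 (Finsupp.mem_support_iff.1 hl)
    have hwt : hallWeight w α = hallWeight w (α - Finsupp.single l 1) + (w l).length := by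
      rw [← hallWeight_single (w := w), ← map_add, tsub_add_cancel_of_le hle]
    have hα' : (hallWeight w α : ℤ) ≤ e := hα
    have h := mul_mem_weightLE (monomial_mem_weightLE (w := w)
      (α := α - Finsupp.single l 1) le_rfl (α l : ℝ)) (hf l)
    exact weightLE_mono (by omega) h
  | zero => rw [map_zero]; exact Submodule.zero_mem _
  | add p q _ _ hp hq => rw [map_add]; exact Submodule.add_mem _ hp hq
  | smul a p _ hp => rw [Derivation.map_smul]; exact Submodule.smul_mem _ a hp

namespace IsHallEnumeration

/-- The missing 1 is the degree of the root generator; it makes the generator fields lower the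
weight by 1. -/
theorem hallWeight_multiIndex (hw : IsHallEnumeration s w) (l : Fin n) :
    hallWeight w (multiIndex w (w l)) + 1 = (w l).length := by
  induction l using hw.hall_induction with
  | of l q h => rw [h, multiIndex_of, map_zero]; rfl
  | mul l a b h iha _ =>
    rw [h, multiIndex_mul hw.injective, map_add, hallWeight_single, freeMagma_length_mul]
    omega

theorem generatorField_mem_lowering (hw : IsHallEnumeration s w) (q : Fin r) :
    generatorField w q ∈ lowering w 1 := by
  refine mkDerivation_mem_lowering fun l => ?_
  split_ifs
  · have := hw.hallWeight_multiIndex l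
    exact monomial_mem_weightLE (by omega) _
  · exact Submodule.zero_mem _

theorem evalField_mem_lowering (hw : IsHallEnumeration s w) (x : FreeMagma (Fin r)) :
    evalField w x ∈ lowering w x.length := by
  induction x with
  | ih1 q => exact hw.generatorField_mem_lowering q
  | ih2 x y hx hy => exact lie_mem_lowering hx hy

/-- Coordinates have weight at most `s`, so such a field sends each of them to negative weight. -/
theorem eq_zero_of_mem_lowering (hw : IsHallEnumeration s w) (hs : 1 ≤ s) {k : ℕ} (hk : s < k)
    {D : PolyField n} (hD : D ∈ lowering w k) : D = 0 := by
  refine derivation_ext fun l => ?_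
  have hX : (X l : MvPolynomial (Fin n) ℝ) ∈ weightLE w (w l).length :=
    monomial_mem_weightLE (by rw [hallWeight_single]) 1
  have := hw.length_le hs l
  rw [eq_zero_of_mem_weightLE (by omega) (hD _ _ hX), Derivation.zero_apply]

theorem hallLie_le_lowering (hw : IsHallEnumeration s w) {D : PolyField n} (hD : D ∈ hallLie w) :
    D ∈ lowering w 1 := by
  induction hD using LieSubalgebra.lieSpan_induction with
  | mem x hx =>
    obtain ⟨q, rfl⟩ := hx
    exact hw.generatorField_mem_lowering q
  | zero => exact Submodule.zero_mem _
  | add x y _ _ hx hy => exact Submodule.add_mem _ hx hy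
  | smul a x _ hx => exact Submodule.smul_mem _ a hx
  | lie x y _ _ hx hy => exact lowering_anti (by omega) (lie_mem_lowering hx hy)

theorem lowerCentralSeries_hallLie_le_lowering (hw : IsHallEnumeration s w) (k : ℕ)
    {D : hallLie w} (hD : D ∈ LieModule.lowerCentralSeries ℝ (hallLie w) (hallLie w) k) :
    (D : PolyField n) ∈ lowering w (k + 1) := by
  induction k generalizing D with
  | zero => exact hw.hallLie_le_lowering D.2
  | succ k ih =>
    have : D ∈ (lowering w (k + 1 + 1)).comap (hallLie w).toSubmodule.subtype := by
      refine lowerCentralSeries_succ_induction (fun x y hy => ?_) hD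
      have := lie_mem_lowering (hw.hallLie_le_lowering x.2) (ih hy)
      rwa [add_comm] at this
    exact this

theorem lowerCentralSeries_hallLie_eq_bot (hw : IsHallEnumeration s w) (hs : 1 ≤ s) :
    LieModule.lowerCentralSeries ℝ (hallLie w) (hallLie w) s = ⊥ := by
  rw [eq_bot_iff]
  intro D hD
  rw [LieSubmodule.mem_bot]
  exact Subtype.ext (hw.eq_zero_of_mem_lowering hs (Nat.lt_succ_self s)
    (hw.lowerCentralSeries_hallLie_le_lowering s hD))

end IsHallEnumeration

end Filtration

/-! ### Basis of 𝔤 and isomorphism with the free nilpotent algebra -/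

section Isomorphism

variable {r n s : ℕ} {w : Fin n → FreeMagma (Fin r)}

/-- The generators of the Lie algebra generated by `X_1, …, X_r`. -/
def hallLieGen (w : Fin n → FreeMagma (Fin r)) (q : Fin r) : hallLie w :=
  ⟨generatorField w q, LieSubalgebra.subset_lieSpan ⟨q, rfl⟩⟩

theorem coe_evalLie_hallLieGen (x : FreeMagma (Fin r)) :
    ((evalLie (hallLieGen w) x : hallLie w) : PolyField n) = evalField w x := by
  induction x with
  | ih1 q => rfl
  | ih2 x y hx hy => rw [evalLie_mul, evalField_mul, LieSubalgebra.coe_bracket, hx, hy]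

/-- The Hall vector field `X_i` as an element of the Lie algebra generated by `X_1, …, X_r`. -/
def hallLieField (w : Fin n → FreeMagma (Fin r)) (i : Fin n) : hallLie w :=
  evalLie (hallLieGen w) (w i)

theorem coe_hallLieField (i : Fin n) : (hallLieField w i : PolyField n) = hallField w i :=
  coe_evalLie_hallLieGen (w i)

/-- The homomorphism from the free Lie algebra taking the generators to `X_1, …, X_r`. -/
def freeToHallLie (w : Fin n → FreeMagma (Fin r)) : FreeLieAlgebra ℝ (Fin r) →ₗ⁅ℝ⁆ hallLie w :=
  FreeLieAlgebra.lift ℝ (hallLieGen w)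

theorem freeToHallLie_of (q : Fin r) :
    freeToHallLie w (FreeLieAlgebra.of ℝ q) = hallLieGen w q :=
  FreeLieAlgebra.lift_of_apply _ _

theorem lieSpan_range_hallLieGen (w : Fin n → FreeMagma (Fin r)) :
    LieSubalgebra.lieSpan ℝ (hallLie w) (Set.range (hallLieGen w)) = ⊤ := by
  have h : Set.range (hallLieGen w) = Subtype.val ⁻¹' Set.range (generatorField w) := by
    ext x
    exact ⟨fun ⟨q, hq⟩ => ⟨q, congrArg Subtype.val hq⟩, fun ⟨q, hq⟩ => ⟨q, Subtype.ext hq⟩⟩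
  rw [h]
  exact LieSubalgebra.lieSpan_lieSpan_coe_preimage

theorem freeToHallLie_surjective (w : Fin n → FreeMagma (Fin r)) :
    Function.Surjective (freeToHallLie w) := by
  have h : LieSubalgebra.lieSpan ℝ (hallLie w) (Set.range (hallLieGen w)) ≤
      (freeToHallLie w).range := by
    rw [LieSubalgebra.lieSpan_le]
    rintro _ ⟨q, rfl⟩
    exact ⟨FreeLieAlgebra.of ℝ q, freeToHallLie_of q⟩
  intro x
  exact h ((lieSpan_range_hallLieGen w).symm ▸ LieSubalgebra.mem_top x)

/-- The quotient map onto the free nilpotent Lie algebra. -/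
def freeNilpotentMk (r s : ℕ) : FreeLieAlgebra ℝ (Fin r) →ₗ⁅ℝ⁆ FreeNilpotent r s where
  __ := (LieModule.lowerCentralSeries ℝ (FreeLieAlgebra ℝ (Fin r))
    (FreeLieAlgebra ℝ (Fin r)) s).toSubmodule.mkQ
  map_lie' := by
    intro x y
    exact LieSubmodule.Quotient.mk_bracket _ x y

theorem freeNilpotentMk_surjective (r s : ℕ) : Function.Surjective (freeNilpotentMk r s) :=
  Submodule.mkQ_surjective _

theorem freeNilpotentMk_eq_zero {x : FreeLieAlgebra ℝ (Fin r)}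
    (hx : x ∈ LieModule.lowerCentralSeries ℝ (FreeLieAlgebra ℝ (Fin r))
      (FreeLieAlgebra ℝ (Fin r)) s) : freeNilpotentMk r s x = 0 :=
  (Submodule.Quotient.mk_eq_zero _).2 hx

theorem evalLie_gen_eq_zero (x : FreeMagma (Fin r)) (hx : s < x.length) :
    evalLie (FreeNilpotent.gen r s) x = 0 := by
  have h := map_evalLie (freeNilpotentMk r s) (FreeLieAlgebra.of ℝ) x
  rw [freeNilpotentMk_eq_zero (evalLie_mem_lowerCentralSeries _ x hx)] at h
  exact h.symm

theorem lieSpan_range_gen (r s : ℕ) :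
    LieSubalgebra.lieSpan ℝ (FreeNilpotent r s) (Set.range (FreeNilpotent.gen r s)) = ⊤ := by
  have h : LieSubalgebra.lieSpan ℝ (FreeLieAlgebra ℝ (Fin r)) (Set.range (FreeLieAlgebra.of ℝ)) ≤
      (LieSubalgebra.lieSpan ℝ (FreeNilpotent r s) (Set.range (FreeNilpotent.gen r s))).comap
        (freeNilpotentMk r s) := by
    rw [LieSubalgebra.lieSpan_le]
    rintro _ ⟨q, rfl⟩
    exact LieSubalgebra.subset_lieSpan ⟨q, rfl⟩
  rw [eq_top_iff]
  rintro x -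
  obtain ⟨y, rfl⟩ := freeNilpotentMk_surjective r s x
  exact h ((lieSpan_range_freeLieAlgebra_of (Fin r)).symm ▸ LieSubalgebra.mem_top y)

namespace IsHallEnumeration

theorem linearIndependent_hallLieField (hw : IsHallEnumeration s w) :
    LinearIndependent ℝ (hallLieField w) := by
  rw [Fintype.linearIndependent_iff]
  intro c hc
  refine Fintype.linearIndependent_iff.1 hw.linearIndependent_hallField c ?_
  have h := congrArg (hallLie w).toSubmodule.subtype hc
  rw [map_sum, map_zero] at h
  refine Eq.trans (Finset.sum_congr rfl fun i _ => ?_) h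
  rw [map_smul]
  exact congrArg (c i • ·) (coe_hallLieField i).symm

theorem evalLie_hallLieGen_eq_zero (hw : IsHallEnumeration s w) (hs : 1 ≤ s)
    (x : FreeMagma (Fin r)) (hx : s < x.length) : evalLie (hallLieGen w) x = 0 := by
  refine Subtype.ext ?_
  rw [coe_evalLie_hallLieGen]
  exact hw.eq_zero_of_mem_lowering hs hx (hw.evalField_mem_lowering x)

theorem span_hallLieField (hw : IsHallEnumeration s w) (hs : 1 ≤ s) :
    Submodule.span ℝ (Set.range (hallLieField w)) = ⊤ := by
  rw [eq_top_iff]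
  rintro x -
  refine hw.lieSpan_le_span (hallLieGen w) (hw.evalLie_hallLieGen_eq_zero hs) ?_
  rw [lieSpan_range_hallLieGen]
  exact LieSubalgebra.mem_top x

/-- The basis `X_1, …, X_n`. -/
def hallBasis (hw : IsHallEnumeration s w) (hs : 1 ≤ s) : Module.Basis (Fin n) ℝ (hallLie w) :=
  Module.Basis.mk hw.linearIndependent_hallLieField (hw.span_hallLieField hs).ge

theorem hallBasis_apply (hw : IsHallEnumeration s w) (hs : 1 ≤ s) (i : Fin n) :
    hw.hallBasis hs i = hallLieField w i := by
  rw [hallBasis, Module.Basis.mk_apply]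

theorem exists_freeNilpotent_equiv (hw : IsHallEnumeration s w) (hs : 1 ≤ s) :
    ∃ e : FreeNilpotent r s ≃ₗ⁅ℝ⁆ hallLie w,
      ∀ q : Fin r, e (FreeNilpotent.gen r s q) = hallLieGen w q := by
  have hker : ∀ x ∈ LieModule.lowerCentralSeries ℝ (FreeLieAlgebra ℝ (Fin r))
      (FreeLieAlgebra ℝ (Fin r)) s, freeToHallLie w x = 0 := by
    intro x hx
    have h := LieIdeal.map_lowerCentralSeries_le s (f := freeToHallLie w)
      (LieIdeal.mem_map hx)
    rwa [hw.lowerCentralSeries_hallLie_eq_bot hs, LieSubmodule.mem_bot] at h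
  let f : FreeNilpotent r s →ₗ[ℝ] hallLie w :=
    Submodule.liftQ _ (freeToHallLie w : FreeLieAlgebra ℝ (Fin r) →ₗ[ℝ] hallLie w) hker
  have hf : ∀ x, f (freeNilpotentMk r s x) = freeToHallLie w x := fun _ => rfl
  let F : FreeNilpotent r s →ₗ⁅ℝ⁆ hallLie w :=
    { f with
      map_lie' := by
        intro x y
        obtain ⟨x, rfl⟩ := freeNilpotentMk_surjective r s x
        obtain ⟨y, rfl⟩ := freeNilpotentMk_surjective r s y
        change f _ = ⁅f _, f _⁆
        rw [← LieHom.map_lie, hf, hf, hf, LieHom.map_lie] }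
  have hFgen : ∀ q, F (FreeNilpotent.gen r s q) = hallLieGen w q := fun q => freeToHallLie_of q
  have hsurj : Function.Surjective F := by
    intro y
    obtain ⟨x, rfl⟩ := freeToHallLie_surjective w y
    exact ⟨freeNilpotentMk r s x, hf x⟩
  have hinj : Function.Injective F := by
    rw [injective_iff_map_eq_zero]
    intro x hx
    -- The Hall brackets span the free nilpotent algebra, and their images are the independent Hall
    -- fields; a kernel element therefore has zero coefficients.
    have hx' := hw.lieSpan_le_span (FreeNilpotent.gen r s) evalLie_gen_eq_zero
      (x := x) ((lieSpan_range_gen r s).symm ▸ LieSubalgebra.mem_top x)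
    obtain ⟨c, rfl⟩ := (Submodule.mem_span_range_iff_exists_fun ℝ).1 hx'
    have hc : ∑ i, c i • hallLieField w i = 0 := by
      rw [← hx, map_sum]
      refine Finset.sum_congr rfl fun i _ => ?_
      rw [map_smul, map_evalLie]
      simp only [hFgen]
      rfl
    refine Finset.sum_eq_zero fun i _ => ?_
    rw [Fintype.linearIndependent_iff.1 hw.linearIndependent_hallLieField c hc i, zero_smul]
  exact ⟨LieEquiv.ofBijective F ⟨hinj, hsurj⟩, hFgen⟩

end IsHallEnumeration

end Isomorphism

/-! ### Conjugation by a truncated exponential -/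

section Exponential

variable {R : Type*} [Ring R] [Algebra ℝ R]

/-- The exponential series truncated at order `M`. -/
def truncExp (M : ℕ) (N : R) : R := ∑ j ∈ Finset.range M, (j.factorial : ℝ)⁻¹ • N ^ j

theorem succ_smul_inv_factorial_smul_pow (N : R) (j : ℕ) :
    ((j : ℝ) + 1) • (((j + 1).factorial : ℝ)⁻¹ • N ^ (j + 1)) =
      ((j.factorial : ℝ)⁻¹ • N ^ j) * N := by
  have h : (j.factorial : ℝ) ≠ 0 := by positivity
  have h' : (j : ℝ) + 1 ≠ 0 := by positivity
  rw [smul_smul, smul_mul_assoc, pow_succ, Nat.factorial_succ]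
  congr 1
  push_cast
  field_simp

/-- This is the coefficient of t^j in C 0 · e^{tN} = e^{tN} ∑ t^m C m. In the induction both sides
are multiplied by j + 1, which on the right is split as p.1 + p.2. -/
theorem mul_inv_factorial_smul_pow {N : R} {C : ℕ → R}
    (hC : ∀ m : ℕ, C m * N = N * C m + ((m : ℝ) + 1) • C (m + 1)) (j : ℕ) :
    C 0 * ((j.factorial : ℝ)⁻¹ • N ^ j) =
      ∑ p ∈ Finset.HasAntidiagonal.antidiagonal j, ((p.1.factorial : ℝ)⁻¹ • N ^ p.1) * C p.2 := by
  induction j with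
  | zero => simp
  | succ j ih =>
    have hj : (j : ℝ) + 1 ≠ 0 := by positivity
    refine smul_right_injective R hj ?_
    set e : ℕ → R := fun j => (j.factorial : ℝ)⁻¹ • N ^ j with he
    have he1 : ∀ l : ℕ, ((l : ℝ) + 1) • e (l + 1) = e l * N :=
      succ_smul_inv_factorial_smul_pow N
    change ((j : ℝ) + 1) • (C 0 * e (j + 1)) =
      ((j : ℝ) + 1) • ∑ p ∈ Finset.HasAntidiagonal.antidiagonal (j + 1), e p.1 * C p.2
    have hl : ((j : ℝ) + 1) • (C 0 * e (j + 1)) =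
        ∑ p ∈ Finset.HasAntidiagonal.antidiagonal j, ((((p.1 : ℝ) + 1) • (e (p.1 + 1) * C p.2)) +
          ((p.2 : ℝ) + 1) • (e p.1 * C (p.2 + 1))) := by
      rw [← mul_smul_comm, he1, ← mul_assoc]
      change C 0 * e j = ∑ p ∈ Finset.HasAntidiagonal.antidiagonal j, e p.1 * C p.2 at ih
      rw [ih, Finset.sum_mul]
      refine Finset.sum_congr rfl fun p _ => ?_
      rw [mul_assoc, hC, mul_add, ← mul_assoc, ← he1, smul_mul_assoc, mul_smul_comm]
    have hr : ((j : ℝ) + 1) • ∑ p ∈ Finset.HasAntidiagonal.antidiagonal (j + 1), e p.1 * C p.2 =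
        ∑ p ∈ Finset.HasAntidiagonal.antidiagonal (j + 1), (p.1 : ℝ) • (e p.1 * C p.2) +
          ∑ p ∈ Finset.HasAntidiagonal.antidiagonal (j + 1), (p.2 : ℝ) • (e p.1 * C p.2) := by
      rw [← Finset.sum_add_distrib, Finset.smul_sum]
      refine Finset.sum_congr rfl fun p hp => ?_
      rw [← add_smul]
      congr 1
      exact_mod_cast (Finset.HasAntidiagonal.mem_antidiagonal.1 hp).symm
    rw [hl, hr, Finset.Nat.sum_antidiagonal_succ (f := fun p => (p.1 : ℝ) • (e p.1 * C p.2)),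
      Finset.Nat.sum_antidiagonal_succ' (f := fun p => (p.2 : ℝ) • (e p.1 * C p.2))]
    simp [Finset.sum_add_distrib]

/-- If iterated commutators with `N` are `C 0, 1! C 1, 2! C 2, …`, then `e^{-N} (C 0) e^N` is
`∑ C m`. -/
theorem mul_truncExp {M : ℕ} {N : R} (hN : N ^ M = 0) {C : ℕ → R}
    (hC : ∀ m : ℕ, C m * N = N * C m + ((m : ℝ) + 1) • C (m + 1)) (hCM : ∀ m, M ≤ m → C m = 0) :
    C 0 * truncExp M N = truncExp M N * ∑ m ∈ Finset.range M, C m := by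
  have hN' : ∀ j, M ≤ j → N ^ j = 0 := fun j hj => pow_eq_zero_of_le hj hN
  set f : ℕ × ℕ → R := fun p => ((p.1.factorial : ℝ)⁻¹ • N ^ p.1) * C p.2 with hf
  -- The product on the other side has total degrees below 2M, so the series is padded with
  -- vanishing terms to allow comparison degree by degree.
  have h1 : truncExp M N = ∑ j ∈ Finset.range (M + M), (j.factorial : ℝ)⁻¹ • N ^ j := by
    refine Finset.sum_subset (Finset.range_mono (by omega)) fun j _ hj => ?_
    rw [hN' j (by simpa using hj), smul_zero]
  have h2 : truncExp M N * ∑ m ∈ Finset.range M, C m =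
      ∑ p ∈ Finset.range M ×ˢ Finset.range M, f p := by
    rw [truncExp, Finset.sum_mul_sum, Finset.sum_product]
  rw [h2, h1, Finset.mul_sum,
    ← Finset.sum_fiberwise_of_maps_to (t := Finset.range (M + M)) (g := fun p : ℕ × ℕ => p.1 + p.2)]
  · refine Finset.sum_congr rfl fun j _ => ?_
    rw [mul_inv_factorial_smul_pow hC]
    symm
    refine Finset.sum_subset (fun p hp => ?_) fun p hp hp' => ?_
    · exact Finset.HasAntidiagonal.mem_antidiagonal.2 (Finset.mem_filter.1 hp).2
    · have hp'' : M ≤ p.1 ∨ M ≤ p.2 := by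
        by_contra! h
        refine hp' (Finset.mem_filter.2 ⟨?_, Finset.HasAntidiagonal.mem_antidiagonal.1 hp⟩)
        exact Finset.mem_product.2 ⟨Finset.mem_range.2 h.1, Finset.mem_range.2 h.2⟩
      rcases hp'' with h | h
      · rw [hf]
        simp only [hN' _ h, smul_zero, zero_mul]
      · rw [hf]
        simp only [hCM _ h, mul_zero]
  · intro p hp
    simp only [Finset.mem_product, Finset.mem_range] at hp ⊢
    omega

/-- Conjugation by `e^N` in the case where `N` commutes with `a`, the commutator of `D` with `N`,
and the iterated commutators of `B 0` with `N` are `B 0, 1! B 1, 2! B 2, …`. -/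
theorem sub_mul_truncExp {t : ℕ} {N D a : R} (hN : N ^ (t + 2) = 0) {B : ℕ → R}
    (hDN : D * N = N * D + a) (haN : a * N = N * a)
    (hBN : ∀ m : ℕ, B m * N = N * B m + ((m : ℝ) + 1) • B (m + 1))
    (hBt : ∀ m, t ≤ m → B m = 0) :
    (D - (a + B 0)) * truncExp (t + 2) N =
      truncExp (t + 2) N * (D - ∑ m ∈ Finset.range (t + 2), B m) := by
  -- The derivation contributes only to orders 0 and 1, since [D, N] = a commutes with `N`; the two
  -- copies of `a` cancel in the sum. The order t + 2 ensures that both exceptional terms are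
  -- present.
  let C : ℕ → R
    | 0 => D - (a + B 0)
    | 1 => a - B 1
    | m + 2 => -B (m + 2)
  have hC : ∀ m : ℕ, C m * N = N * C m + ((m : ℝ) + 1) • C (m + 1) := by
    intro m
    match m with
    | 0 =>
      change (D - (a + B 0)) * N = N * (D - (a + B 0)) + (((0 : ℕ) : ℝ) + 1) • (a - B 1)
      rw [sub_mul, add_mul, hDN, haN, hBN, Nat.cast_zero, zero_add, one_smul, one_smul, mul_sub,
        mul_add]
      abel
    | 1 =>
      change (a - B 1) * N = N * (a - B 1) + (((1 : ℕ) : ℝ) + 1) • (-B 2)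
      rw [sub_mul, haN, hBN, mul_sub, smul_neg]
      abel
    | m + 2 =>
      change -B (m + 2) * N = N * -B (m + 2) + (((m + 2 : ℕ) : ℝ) + 1) • (-B (m + 3))
      rw [neg_mul, hBN, mul_neg, smul_neg]
      abel
  have hCM : ∀ m, t + 2 ≤ m → C m = 0 := by
    intro m hm
    obtain ⟨m, rfl⟩ := Nat.exists_eq_add_of_le' (show 2 ≤ m by omega)
    change -B (m + 2) = 0
    rw [hBt _ (by omega), neg_zero]
  have hsum : ∑ m ∈ Finset.range (t + 2), C m = D - ∑ m ∈ Finset.range (t + 2), B m := by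
    rw [Finset.sum_range_succ' _ (t + 1), Finset.sum_range_succ' _ t,
      Finset.sum_range_succ' B (t + 1), Finset.sum_range_succ' _ t]
    have h2 : ∑ m ∈ Finset.range t, C (m + 1 + 1) = -∑ m ∈ Finset.range t, B (m + 1 + 1) := by
      rw [← Finset.sum_neg_distrib]
    rw [h2]
    change _ + (a - B 1) + (D - (a + B 0)) = D - (_ + B 1 + B 0)
    abel
  rw [← hsum]
  exact mul_truncExp hN hC hCM

end Exponential

/-! ### Operators on polynomial-valued functionals -/

section Operators

open MvPolynomial

variable {n : ℕ} {L : Type*} [LieRing L] [LieAlgebra ℝ L]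

/-- The operator `f ↦ p • f ∘ ad Y` on polynomial valued functionals. -/
def twist (p : MvPolynomial (Fin n) ℝ) (Y : L) :
    Module.End ℝ (L →ₗ[ℝ] MvPolynomial (Fin n) ℝ) where
  toFun f := p • (f ∘ₗ (LieAlgebra.ad ℝ L Y : L →ₗ[ℝ] L))
  map_add' f g := by ext; simp [mul_add]
  map_smul' a f := by ext; simp

theorem twist_apply (p : MvPolynomial (Fin n) ℝ) (Y : L) (f : L →ₗ[ℝ] MvPolynomial (Fin n) ℝ)
    (Z : L) : twist p Y f Z = p * f ⁅Y, Z⁆ := rfl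

/-- The operator `f ↦ D ∘ f` on polynomial valued functionals. -/
def derivOp (L : Type*) [LieRing L] [LieAlgebra ℝ L] (D : PolyField n) :
    Module.End ℝ (L →ₗ[ℝ] MvPolynomial (Fin n) ℝ) where
  toFun f := (D : MvPolynomial (Fin n) ℝ →ₗ[ℝ] MvPolynomial (Fin n) ℝ) ∘ₗ f
  map_add' f g := by ext; simp
  map_smul' a f := by ext; simp

theorem derivOp_apply (D : PolyField n) (f : L →ₗ[ℝ] MvPolynomial (Fin n) ℝ) (Z : L) :
    derivOp L D f Z = D (f Z) := rfl

/-- Precomposition reverses products, hence [Z, Y] instead of [Y, Z]. -/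
theorem twist_mul_twist (p q : MvPolynomial (Fin n) ℝ) (Y Z : L) :
    twist p Y * twist q Z = twist q Z * twist p Y + twist (p * q) ⁅Z, Y⁆ := by
  refine LinearMap.ext fun f => LinearMap.ext fun W => ?_
  simp only [Module.End.mul_apply, LinearMap.add_apply, twist_apply, lie_lie, map_sub]
  ring

theorem derivOp_mul_twist (D : PolyField n) (p : MvPolynomial (Fin n) ℝ) (Y : L) :
    derivOp L D * twist p Y = twist p Y * derivOp L D + twist (D p) Y := by
  refine LinearMap.ext fun f => LinearMap.ext fun W => ?_
  simp only [Module.End.mul_apply, LinearMap.add_apply, twist_apply, derivOp_apply,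
    Derivation.leibniz, smul_eq_mul]
  ring

theorem twist_zero_left (Y : L) : twist (0 : MvPolynomial (Fin n) ℝ) Y = 0 := by
  refine LinearMap.ext fun f => LinearMap.ext fun W => ?_
  simp [twist_apply]

theorem twist_zero_right (p : MvPolynomial (Fin n) ℝ) : twist p (0 : L) = 0 := by
  refine LinearMap.ext fun f => LinearMap.ext fun W => ?_
  simp [twist_apply]

theorem smul_twist (a : ℝ) (p : MvPolynomial (Fin n) ℝ) (Y : L) :
    a • twist p Y = twist (a • p) Y := by
  refine LinearMap.ext fun f => LinearMap.ext fun W => ?_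
  simp [twist_apply]

theorem twist_neg_left (p : MvPolynomial (Fin n) ℝ) (Y : L) : twist (-p) Y = twist p (-Y) := by
  refine LinearMap.ext fun f => LinearMap.ext fun W => ?_
  rw [twist_apply, twist_apply, neg_lie, map_neg, neg_mul, mul_neg]

theorem twist_pow_apply (p : MvPolynomial (Fin n) ℝ) (Y : L) (m : ℕ)
    (f : L →ₗ[ℝ] MvPolynomial (Fin n) ℝ) (Z : L) :
    (twist p Y ^ m) f Z = p ^ m * f ((LieAlgebra.ad ℝ L Y ^ m) Z) := by
  induction m generalizing f with
  | zero => simp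
  | succ m ih =>
    rw [pow_succ, Module.End.mul_apply, ih, twist_apply, pow_succ, mul_assoc,
      pow_succ' (_ : Module.End ℝ L), Module.End.mul_apply, LieAlgebra.ad_apply]

theorem twist_pow_eq_zero (p : MvPolynomial (Fin n) ℝ) {Y : L} {M : ℕ}
    (hY : LieAlgebra.ad ℝ L Y ^ M = 0) : twist p Y ^ M = 0 := by
  refine LinearMap.ext fun f => LinearMap.ext fun W => ?_
  rw [twist_pow_apply, hY]
  simp

end Operators

/-! ### Lazard elimination along the Hall basis -/

section Elimination

open MvPolynomial

variable {r n s : ℕ} {w : Fin n → FreeMagma (Fin r)} {L : Type*} [LieRing L] [LieAlgebra ℝ L]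

/-- The Hall elements `i ≥ k` which are generators or were constructed as `[h, l]` with `l < k`. -/
def eliminationSet (w : Fin n → FreeMagma (Fin r)) (k : ℕ) : Finset (Fin n) := by
  classical
  exact Finset.univ.filter fun i => k ≤ (i : ℕ) ∧ ∀ h l, w i = w h * w l → (l : ℕ) < k

theorem mem_eliminationSet {k : ℕ} {i : Fin n} : i ∈ eliminationSet w k ↔
    k ≤ (i : ℕ) ∧ ∀ h l, w i = w h * w l → (l : ℕ) < k := by
  simp [eliminationSet]

/-- The elements of the elimination set for `k + 1` of the form `[h, k, …, k]` with exactly `m`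
occurrences of `k`. -/
def eliminationLayer (w : Fin n → FreeMagma (Fin r)) (k : Fin n) (m : ℕ) : Finset (Fin n) :=
  (eliminationSet w (k + 1)).filter fun i => multiIndex w (w i) k = m

theorem mem_eliminationLayer {k : Fin n} {m : ℕ} {i : Fin n} : i ∈ eliminationLayer w k m ↔
    k < i ∧ FactorLE w i k ∧ multiIndex w (w i) k = m := by
  rw [eliminationLayer, Finset.mem_filter, mem_eliminationSet, and_assoc]
  simp only [Nat.lt_succ_iff, Nat.succ_le_iff, FactorLE, Fin.val_fin_le, Fin.val_fin_lt]

/-- `∑ (X_q x_i) • ad X_i` over a set of Hall elements. -/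
def generatorSum (w : Fin n → FreeMagma (Fin r)) (g : Fin r → L) (q : Fin r) (S : Finset (Fin n)) :
    Module.End ℝ (L →ₗ[ℝ] MvPolynomial (Fin n) ℝ) :=
  ∑ i ∈ S, twist (generatorField w q (X i)) (evalLie g (w i))

namespace IsHallEnumeration

theorem factorLE_of_mul (hw : IsHallEnumeration s w) {i a b : Fin n} (h : w i = w a * w b) :
    FactorLE w i b := fun _ _ hcd =>
  (hw.injective (freeMagma_mul_inj.1 (hcd.symm.trans h)).2).le

/-- Passing from `a` to [a, b] keeps the root and raises the exponent of x_b by 1, so the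
normalization (-1)^{|I|}/I! supplies the sign and the factor. -/
theorem generatorField_X_mul (hw : IsHallEnumeration s w) (q : Fin r) {i a b : Fin n}
    (h : w i = w a * w b) :
    ((multiIndex w (w a) b : ℝ) + 1) • generatorField w q (X i) =
      -(generatorField w q (X a) * X b) := by
  rw [generatorField, mkDerivation_X, mkDerivation_X, h, root_mul]
  split_ifs
  · rw [multiIndex_mul hw.injective, smul_monomial, X, monomial_mul, mul_one, ← map_neg,
      smul_eq_mul, mul_comm, signedInvFactorial_add_single]
  · rw [smul_zero, zero_mul, neg_zero]

theorem eliminationSet_eq_insert (hw : IsHallEnumeration s w) (k : Fin n) :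
    eliminationSet w k = insert k (eliminationLayer w k 0) := by
  ext i
  rw [Finset.mem_insert, mem_eliminationSet, mem_eliminationLayer]
  constructor
  · rintro ⟨h1, h2⟩
    by_cases hik : i = k
    · exact Or.inl hik
    · refine Or.inr ⟨lt_of_le_of_ne h1 (Ne.symm hik), fun a b hab => (h2 a b hab).le, ?_⟩
      rcases hw.of_or_mul i with ⟨p, hp⟩ | ⟨a, b, hab⟩
      · rw [hp]; rfl
      · exact hw.multiIndex_eq_zero (hw.factorLE_of_mul hab) (h2 a b hab)
  · rintro (rfl | ⟨h1, h2, h3⟩)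
    · exact ⟨le_rfl, fun a b hab => (hw.mul_factors hab).2.2.2.1⟩
    · refine ⟨h1.le, fun a b hab => lt_of_le_of_ne (h2 a b hab) fun hbk => ?_⟩
      obtain rfl : b = k := Fin.ext hbk
      rw [hab, multiIndex_mul hw.injective, Finsupp.add_apply, Finsupp.single_eq_same] at h3
      omega

/-- The initial elimination set consists of the generators, on whose coordinates X_q acts as a
Kronecker delta. -/
theorem generatorSum_zero (hw : IsHallEnumeration s w) (g : Fin r → L) (q : Fin r) :
    generatorSum w g q (eliminationSet w 0) = twist 1 (g q) := by
  rw [generatorSum, Finset.sum_eq_single (Fin.castLE hw.rank_le q)]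
  · rw [generatorField_X, hw.gen, extCoeff_self]
    rfl
  · intro i hi hne
    rcases hw.of_or_mul i with ⟨p, hp⟩ | ⟨a, b, hab⟩
    · rw [generatorField_X, hp, extCoeff_of_not_extends, twist_zero_left]
      intro h
      rw [extends_of] at h
      exact hne (hw.injective (hp.trans (h.trans (hw.gen q).symm)))
    · exact absurd ((mem_eliminationSet.1 hi).2 a b hab) (Nat.not_lt_zero _)
  · intro h
    refine absurd (mem_eliminationSet.2 ⟨Nat.zero_le _, fun a b hab => ?_⟩) h
    rw [hw.gen] at hab
    exact absurd hab (freeMagma_of_ne_mul _ _ _)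

/-- The map h ↦ [h, k] carries layer `m` onto layer `m + 1`, apart from those `h` whose bracket with
`k` has degree above `s` and evaluates to zero. The coefficient recursion provides the factor m + 1.
-/
theorem generatorSum_layer_mul (hw : IsHallEnumeration s w) {g : Fin r → L}
    (hg : ∀ x : FreeMagma (Fin r), s < x.length → evalLie g x = 0) (q : Fin r) (k : Fin n)
    (m : ℕ) :
    generatorSum w g q (eliminationLayer w k m) * twist (X k) (evalLie g (w k)) =
      twist (X k) (evalLie g (w k)) * generatorSum w g q (eliminationLayer w k m) +
        ((m : ℝ) + 1) • generatorSum w g q (eliminationLayer w k (m + 1)) := by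
  classical
  set T := (eliminationLayer w k m).filter fun h => ∃ i, w i = w h * w k with hT
  have hTmem : ∀ h ∈ T, ∃ i, w i = w h * w k := fun h hh => (Finset.mem_filter.1 hh).2
  rw [generatorSum, generatorSum, Finset.sum_mul, Finset.mul_sum, Finset.smul_sum]
  simp only [twist_mul_twist _ (X k), Finset.sum_add_distrib]
  congr 1
  have hsub : ∑ h ∈ T, twist (generatorField w q (X h) * X k)
      ⁅evalLie g (w k), evalLie g (w h)⁆ = ∑ h ∈ eliminationLayer w k m,
        twist (generatorField w q (X h) * X k) ⁅evalLie g (w k), evalLie g (w h)⁆ := by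
    refine Finset.sum_subset (Finset.filter_subset _ _) fun h hh hhT => ?_
    obtain ⟨hkh, hf, _⟩ := mem_eliminationLayer.1 hh
    -- In this layer h > k and the right factor of `h` is at most `k`, so only the degree bound can
    -- keep [h, k] out of the list.
    rw [← lie_skew, ← evalLie_mul, hg, neg_zero, twist_zero_right]
    by_contra! hlen
    exact hhT (Finset.mem_filter.2 ⟨hh, hw.exists_mul hkh hf hlen⟩)
  rw [← hsub]
  refine Finset.sum_bij (fun h hh => (hTmem h hh).choose) ?_ ?_ ?_ ?_
  · intro h hh
    have hi := (hTmem h hh).choose_spec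
    obtain ⟨hkh, hf, hm⟩ := mem_eliminationLayer.1 (Finset.mem_filter.1 hh).1
    refine mem_eliminationLayer.2 ⟨(hw.mul_factors hi).2.2.2.1, hw.factorLE_of_mul hi, ?_⟩
    rw [hi, multiIndex_mul hw.injective, Finsupp.add_apply, Finsupp.single_eq_same, hm]
  · intro h hh h' hh' heq
    have hi := (hTmem h hh).choose_spec
    have hi' := (hTmem h' hh').choose_spec
    rw [heq, hi'] at hi
    exact (hw.injective (freeMagma_mul_inj.1 hi).1).symm
  · intro i hi
    obtain ⟨hki, hf, hm⟩ := mem_eliminationLayer.1 hi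
    rcases hw.of_or_mul i with ⟨p, hp⟩ | ⟨a, b, hab⟩
    · rw [hp, multiIndex_of] at hm
      simp at hm
    · obtain rfl : b = k := by
        refine le_antisymm (hf a b hab) (le_of_not_gt fun hlt => ?_)
        rw [hw.multiIndex_eq_zero (hw.factorLE_of_mul hab) hlt] at hm
        omega
      obtain ⟨hba, hfa, _⟩ := hw.mul_factors hab
      rw [hab, multiIndex_mul hw.injective, Finsupp.add_apply, Finsupp.single_eq_same] at hm
      have haT : a ∈ T := Finset.mem_filter.2
        ⟨mem_eliminationLayer.2 ⟨hba, hfa, Nat.succ_injective hm⟩, i, hab⟩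
      exact ⟨a, haT, hw.injective ((hTmem a haT).choose_spec.trans hab.symm)⟩
  · intro h hh
    have hi := (hTmem h hh).choose_spec
    obtain ⟨_, _, hm⟩ := mem_eliminationLayer.1 (Finset.mem_filter.1 hh).1
    rw [smul_twist, ← hm, hw.generatorField_X_mul q hi, hi, evalLie_mul, twist_neg_left, lie_skew]

/-- Every occurrence of `k`, and also the root, takes up at least one degree. -/
theorem eliminationLayer_eq_empty (hw : IsHallEnumeration s w) (hs : 1 ≤ s) (k : Fin n) {m : ℕ}
    (hm : s ≤ m) : eliminationLayer w k m = ∅ := by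
  refine Finset.eq_empty_of_forall_notMem fun i hi => ?_
  have h1 := hw.multiIndex_le_length i k
  have h2 := hw.length_le hs i
  have h3 := (mem_eliminationLayer.1 hi).2.2
  omega

/-- One elimination step: conjugation by `e^{x_k ad X_k}`. -/
theorem elimination_step (hw : IsHallEnumeration s w) (hs : 1 ≤ s) {g : Fin r → L}
    (hg : ∀ x : FreeMagma (Fin r), s < x.length → evalLie g x = 0)
    (had : ∀ i, LieAlgebra.ad ℝ L (evalLie g (w i)) ^ (s + 2) = 0) (q : Fin r) (k : Fin n) :
    (derivOp L (generatorField w q) - generatorSum w g q (eliminationSet w k)) *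
        truncExp (s + 2) (twist (X k) (evalLie g (w k))) =
      truncExp (s + 2) (twist (X k) (evalLie g (w k))) *
        (derivOp L (generatorField w q) - generatorSum w g q (eliminationSet w (k + 1))) := by
  have h0 : generatorSum w g q (eliminationSet w k) =
      twist (generatorField w q (X k)) (evalLie g (w k)) +
        generatorSum w g q (eliminationLayer w k 0) := by
    rw [hw.eliminationSet_eq_insert, generatorSum, Finset.sum_insert]
    · rfl
    · exact fun h => (mem_eliminationLayer.1 h).1.false
  have h1 : generatorSum w g q (eliminationSet w (k + 1)) =
      ∑ m ∈ Finset.range (s + 2), generatorSum w g q (eliminationLayer w k m) := by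
    rw [generatorSum, ← Finset.sum_fiberwise_of_maps_to (t := Finset.range (s + 2))
      (g := fun i => multiIndex w (w i) k)]
    · rfl
    · intro i _
      have h1 := hw.multiIndex_le_length i k
      have h2 := hw.length_le hs i
      exact Finset.mem_range.2 (by omega)
  rw [h0, h1]
  refine sub_mul_truncExp (R := Module.End ℝ (L →ₗ[ℝ] MvPolynomial (Fin n) ℝ))
    (B := fun m => generatorSum w g q (eliminationLayer w k m))
    (twist_pow_eq_zero _ (had k)) (derivOp_mul_twist _ _ _) ?_
    (hw.generatorSum_layer_mul hg q k) fun m hm => ?_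
  · rw [twist_mul_twist, lie_self, twist_zero_right, add_zero]
  · rw [hw.eliminationLayer_eq_empty hs k hm]
    rfl

end IsHallEnumeration

end Elimination

/-! ### The product of exponentials and its derivative along generators -/

section ExtremalFunctional

open MvPolynomial

variable {r n s : ℕ} {w : Fin n → FreeMagma (Fin r)} {L : Type*} [LieRing L] [LieAlgebra ℝ L]

/-- The polynomial valued functional `v ∘ e^{x_{jₘ} ad Y_{jₘ}} ∘ ⋯ ∘ e^{x_{j₁} ad Y_{j₁}}`, with
exponential series truncated at order `M`. -/
def expFunctional (Y : Fin n → L) (v : L →ₗ[ℝ] ℝ) (M : ℕ) :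
    List (Fin n) → L →ₗ[ℝ] MvPolynomial (Fin n) ℝ
  | [] => Algebra.linearMap ℝ (MvPolynomial (Fin n) ℝ) ∘ₗ v
  | j :: l => truncExp M (twist (X j) (Y j)) (expFunctional Y v M l)

theorem truncExp_twist_apply (M : ℕ) (p : MvPolynomial (Fin n) ℝ) (Y : L)
    (f : L →ₗ[ℝ] MvPolynomial (Fin n) ℝ) (Z : L) :
    truncExp M (twist p Y) f Z =
      ∑ m ∈ Finset.range M, (m.factorial : ℝ)⁻¹ • (p ^ m * f ((LieAlgebra.ad ℝ L Y ^ m) Z)) := by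
  simp only [truncExp, LinearMap.sum_apply, LinearMap.smul_apply, twist_pow_apply]

theorem ad_pow_apply_eq (Y Z : L) (m : ℕ) :
    (LieAlgebra.ad ℝ L Y ^ m) Z = (-1 : ℝ) ^ m • (fun W => ⁅W, Y⁆)^[m] Z := by
  induction m with
  | zero => simp
  | succ m ih =>
    rw [pow_succ' (_ : Module.End ℝ L), Module.End.mul_apply, ih, map_smul, LieAlgebra.ad_apply,
      Function.iterate_succ_apply', ← lie_skew, smul_neg, pow_succ, mul_neg_one, neg_smul]

omit [LieAlgebra ℝ L] in
theorem foldl_iterate_lie_zero (Y : Fin n → L) (α : Fin n →₀ ℕ) (l : List (Fin n)) :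
    l.foldl (fun Z j => (fun W : L => ⁅W, Y j⁆)^[α j] Z) 0 = 0 := by
  induction l with
  | nil => rfl
  | cons j l ih =>
    rw [List.foldl_cons, Function.iterate_fixed (f := fun W : L => ⁅W, Y j⁆) (zero_lie (Y j)), ih]

omit [LieAlgebra ℝ L] in
theorem foldl_iterate_lie_congr (Y : Fin n → L) {α β : Fin n →₀ ℕ} {l : List (Fin n)}
    (h : ∀ j ∈ l, α j = β j) (Z : L) :
    l.foldl (fun Z j => (fun W : L => ⁅W, Y j⁆)^[α j] Z) Z =
      l.foldl (fun Z j => (fun W : L => ⁅W, Y j⁆)^[β j] Z) Z := by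
  induction l generalizing Z with
  | nil => rfl
  | cons j l ih =>
    rw [List.foldl_cons, List.foldl_cons, h j List.mem_cons_self,
      ih fun i hi => h i (List.mem_cons_of_mem _ hi)]

/-- Because the list has no repetitions, x_j is absent from the functional of the tail, and only the
term of order `α j` of the j-th exponential contributes. -/
theorem coeff_expFunctional (Y : Fin n → L) (v : L →ₗ[ℝ] ℝ) {M : ℕ}
    (hM : ∀ j, LieAlgebra.ad ℝ L (Y j) ^ M = 0) {l : List (Fin n)} (hl : l.Nodup)
    (α : Fin n →₀ ℕ) (Z : L) [Decidable (∀ i, i ∉ l → α i = 0)] :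
    coeff α (expFunctional Y v M l Z) = if ∀ i, i ∉ l → α i = 0 then
      (l.map fun j => (-1 : ℝ) ^ α j * ((α j).factorial : ℝ)⁻¹).prod *
        v (l.foldl (fun Z j => (fun W : L => ⁅W, Y j⁆)^[α j] Z) Z) else 0 := by
  classical
  induction l generalizing α Z with
  | nil =>
    change coeff α (C (v Z)) = _
    rw [coeff_C]
    have : (0 = α) ↔ ∀ i, i ∉ ([] : List (Fin n)) → α i = 0 := by
      refine ⟨fun h => by simp [← h], fun h => ?_⟩
      ext i
      exact (h i List.not_mem_nil).symm
    simp only [this, List.map_nil, List.prod_nil, one_mul, List.foldl_nil]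
  | cons j l ih =>
    obtain ⟨hj, hl⟩ := List.nodup_cons.1 hl
    have hterm : ∀ m ∈ Finset.range M, m ≠ α j →
        coeff α ((m.factorial : ℝ)⁻¹ • ((X j : MvPolynomial (Fin n) ℝ) ^ m *
          expFunctional Y v M l ((LieAlgebra.ad ℝ L (Y j) ^ m) Z))) = 0 := by
      intro m _ hm
      rw [coeff_smul, X_pow_eq_monomial, coeff_monomial_mul']
      split_ifs with hle
      · have hlt : m ≤ α j := by simpa using hle j
        rw [ih hl, if_neg, mul_zero, smul_zero]
        intro h
        have := h j hj
        rw [Finsupp.tsub_apply, Finsupp.single_eq_same] at this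
        omega
      · rw [smul_zero]
    have hval : coeff α (((α j).factorial : ℝ)⁻¹ • ((X j : MvPolynomial (Fin n) ℝ) ^ (α j) *
          expFunctional Y v M l ((LieAlgebra.ad ℝ L (Y j) ^ (α j)) Z))) =
        if ∀ i, i ∉ j :: l → α i = 0 then
        ((j :: l).map fun j => (-1 : ℝ) ^ α j * ((α j).factorial : ℝ)⁻¹).prod *
        v ((j :: l).foldl (fun Z j => (fun W : L => ⁅W, Y j⁆)^[α j] Z) Z) else 0 := by
      have hne : ∀ i, i ≠ j → (α - Finsupp.single j (α j)) i = α i := by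
        intro i hi
        rw [Finsupp.tsub_apply, Finsupp.single_eq_of_ne hi, tsub_zero]
      have hne' : ∀ i ∈ l, (α - Finsupp.single j (α j)) i = α i := fun i hi =>
        hne i fun h => hj (h ▸ hi)
      have hcond : (∀ i, i ∉ l → (α - Finsupp.single j (α j)) i = 0) ↔
          ∀ i, i ∉ j :: l → α i = 0 := by
        constructor
        · intro h i hi
          rw [List.mem_cons, not_or] at hi
          rw [← hne i hi.1]
          exact h i hi.2
        · intro h i hi
          by_cases hij : i = j
          · rw [hij, Finsupp.tsub_apply, Finsupp.single_eq_same, tsub_self]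
          · rw [hne i hij]
            exact h i (by simp [hij, hi])
      have hmap : (l.map fun i => (-1 : ℝ) ^ (α - Finsupp.single j (α j)) i *
          (((α - Finsupp.single j (α j)) i).factorial : ℝ)⁻¹) =
          l.map fun i => (-1 : ℝ) ^ α i * ((α i).factorial : ℝ)⁻¹ :=
        List.map_congr_left fun i hi => by rw [hne' i hi]
      rw [coeff_smul, X_pow_eq_monomial, coeff_monomial_mul', if_pos, one_mul, ad_pow_apply_eq,
        map_smul, coeff_smul, ih hl, hmap, foldl_iterate_lie_congr Y hne']
      · simp only [hcond, List.map_cons, List.prod_cons, List.foldl_cons, smul_eq_mul]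
        split_ifs
        · ring
        · simp
      · rw [Finsupp.single_le_iff]
    change coeff α (truncExp M (twist (X j) (Y j)) (expFunctional Y v M l) Z) = _
    rw [truncExp_twist_apply, coeff_sum]
    by_cases hαM : α j < M
    · rw [Finset.sum_eq_single (α j) hterm fun h => absurd (Finset.mem_range.2 hαM) h, hval]
    -- The term of order `α j` has been truncated away, but then the iterated bracket on the other
    -- side vanishes as well.
    · rw [Finset.sum_eq_zero fun m hm => hterm m hm ?_]
      · have h0 : (fun W : L => ⁅W, Y j⁆)^[α j] Z = 0 := by
          have h := ad_pow_apply_eq (Y j) Z (α j)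
          rw [pow_eq_zero_of_le (not_lt.1 hαM) (hM j), LinearMap.zero_apply] at h
          exact (smul_eq_zero.1 h.symm).resolve_left (pow_ne_zero _ (by norm_num))
        rw [List.foldl_cons, h0, foldl_iterate_lie_zero, map_zero, mul_zero, ite_self]
      · rintro rfl
        exact hαM (Finset.mem_range.1 hm)

/-- The coefficients of the full exponential functional. -/
theorem coeff_expFunctional_finRange (Y : Fin n → L) (v : L →ₗ[ℝ] ℝ) {M : ℕ}
    (hM : ∀ j, LieAlgebra.ad ℝ L (Y j) ^ M = 0) (α : Fin n →₀ ℕ) (Z : L) :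
    coeff α (expFunctional Y v M (List.finRange n) Z) =
      signedInvFactorial α * v (iterBracket Y Z α) := by
  classical
  rw [coeff_expFunctional Y v hM (List.nodup_finRange n), if_pos]
  · rw [iterBracket, ← Fin.prod_univ_def, Finset.prod_mul_distrib, Finset.prod_pow_eq_pow_sum,
      Finset.prod_inv_distrib, signedInvFactorial, div_eq_mul_inv]
  · exact fun i hi => absurd (List.mem_finRange i) hi

/-- Here `d` counts the exponentials still to be passed. At the end the elimination set is empty and
the functional takes constant values, which the derivation kills. -/
theorem IsHallEnumeration.elimination (hw : IsHallEnumeration s w) (hs : 1 ≤ s) {g : Fin r → L}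
    (hg : ∀ x : FreeMagma (Fin r), s < x.length → evalLie g x = 0)
    (had : ∀ i, LieAlgebra.ad ℝ L (evalLie g (w i)) ^ (s + 2) = 0) (q : Fin r) (v : L →ₗ[ℝ] ℝ)
    (d k : ℕ) (hk : k + d = n) :
    (derivOp L (generatorField w q) - generatorSum w g q (eliminationSet w k))
      (expFunctional (fun i => evalLie g (w i)) v (s + 2) ((List.finRange n).drop k)) = 0 := by
  induction d generalizing k with
  | zero =>
    have h1 : (List.finRange n).drop k = [] := by
      rw [List.drop_eq_nil_iff, List.length_finRange]
      omega
    have h2 : eliminationSet w k = ∅ := by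
      refine Finset.eq_empty_of_forall_notMem fun i hi => ?_
      have := (mem_eliminationSet.1 hi).1
      omega
    rw [h1, h2, generatorSum, Finset.sum_empty]
    refine LinearMap.ext fun Z => ?_
    rw [LinearMap.sub_apply, LinearMap.zero_apply, sub_zero]
    exact (generatorField w q).map_algebraMap (v Z)
  | succ d ih =>
    have hkn : k < n := by omega
    have h1 : (List.finRange n).drop k = ⟨k, hkn⟩ :: (List.finRange n).drop (k + 1) := by
      rw [List.drop_eq_getElem_cons (by simpa using hkn)]
      simp
    have h2 := hw.elimination_step hs hg had q ⟨k, hkn⟩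
    rw [h1]
    have h3 := LinearMap.congr_fun h2
      (expFunctional (fun i => evalLie g (w i)) v (s + 2) ((List.finRange n).drop (k + 1)))
    rw [Module.End.mul_apply, Module.End.mul_apply, ih (k + 1) (by omega), map_zero] at h3
    exact h3

/-- Differentiating the exponential functional along a generator. -/
theorem IsHallEnumeration.generatorField_expFunctional (hw : IsHallEnumeration s w) (hs : 1 ≤ s)
    {g : Fin r → L} (hg : ∀ x : FreeMagma (Fin r), s < x.length → evalLie g x = 0)
    (had : ∀ i, LieAlgebra.ad ℝ L (evalLie g (w i)) ^ (s + 2) = 0) (q : Fin r) (v : L →ₗ[ℝ] ℝ)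
    (Z : L) :
    generatorField w q
        (expFunctional (fun i => evalLie g (w i)) v (s + 2) (List.finRange n) Z) =
      expFunctional (fun i => evalLie g (w i)) v (s + 2) (List.finRange n) ⁅g q, Z⁆ := by
  have h := hw.elimination hs hg had q v n 0 (zero_add n)
  rw [hw.generatorSum_zero, List.drop_zero] at h
  have h' := LinearMap.congr_fun h Z
  rw [LinearMap.sub_apply, LinearMap.sub_apply, derivOp_apply, twist_apply, one_mul,
    LinearMap.zero_apply, sub_eq_zero] at h'
  exact h'

end ExtremalFunctional

/-! ### Application to 𝔤 -/

section HallLie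

open MvPolynomial

variable {r n s : ℕ} {w : Fin n → FreeMagma (Fin r)}

/-- The functional `∑ c_k X_k ↦ ∑ c_k v_k`. -/
def coordFunctional {L : Type*} [LieRing L] [LieAlgebra ℝ L] (X : Module.Basis (Fin n) ℝ L)
    (v : Fin n → ℝ) : L →ₗ[ℝ] ℝ := ∑ k, v k • X.coord k

theorem coordFunctional_apply {L : Type*} [LieRing L] [LieAlgebra ℝ L]
    (X : Module.Basis (Fin n) ℝ L) (v : Fin n → ℝ) (Y : L) :
    coordFunctional X v Y = ∑ k, X.repr Y k * v k := by
  simp [coordFunctional, mul_comm]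

namespace IsHallEnumeration

/-- The exponent `s` would already do; s + 2 matches the truncation order used in the conjugation.
-/
theorem ad_pow_eq_zero (hw : IsHallEnumeration s w) (hs : 1 ≤ s) (Y : hallLie w) :
    LieAlgebra.ad ℝ (hallLie w) Y ^ (s + 2) = 0 := by
  refine LinearMap.ext fun Z => ?_
  have h : ∀ m, (LieAlgebra.ad ℝ (hallLie w) Y ^ m) Z ∈
      LieModule.lowerCentralSeries ℝ (hallLie w) (hallLie w) m := by
    intro m
    induction m with
    | zero => exact LieSubmodule.mem_top _
    | succ m ih =>
      rw [pow_succ', Module.End.mul_apply, LieAlgebra.ad_apply]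
      exact lie_mem_lowerCentralSeries_succ Y ih
  have h2 := LieModule.antitone_lowerCentralSeries ℝ (hallLie w) (hallLie w)
    (show s ≤ s + 2 by omega) (h (s + 2))
  rw [hw.lowerCentralSeries_hallLie_eq_bot hs, LieSubmodule.mem_bot] at h2
  rw [h2, LinearMap.zero_apply]

theorem iterBracket_eq_zero (hw : IsHallEnumeration s w) (hs : 1 ≤ s) (Y : Fin n → hallLie w)
    {α : Fin n →₀ ℕ} {j : Fin n} (hj : s + 2 ≤ α j) (Z : hallLie w) : iterBracket Y Z α = 0 := by
  have h0 : ∀ Z : hallLie w, (fun W : hallLie w => ⁅W, Y j⁆)^[α j] Z = 0 := by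
    intro Z
    have h := ad_pow_apply_eq (Y j) Z (α j)
    rw [pow_eq_zero_of_le hj (hw.ad_pow_eq_zero hs (Y j)), LinearMap.zero_apply] at h
    exact (smul_eq_zero.1 h.symm).resolve_left (pow_ne_zero _ (by norm_num))
  obtain ⟨l₁, l₂, hl⟩ := List.append_of_mem (List.mem_finRange j)
  rw [iterBracket, hl, List.foldl_append, List.foldl_cons, h0, foldl_iterate_lie_zero]

/-- Nilpotency of each ad X_j confines the relevant multi-indices to a box. -/
theorem finite_phi_ne_zero (hw : IsHallEnumeration s w) (hs : 1 ≤ s)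
    (X : Module.Basis (Fin n) ℝ (hallLie w)) (i : Fin n) :
    {α : Fin n →₀ ℕ | ∃ v : Fin n → ℝ, phi X i α v ≠ 0}.Finite := by
  refine (Set.finite_Iic (Finsupp.equivFunOnFinite.symm fun _ : Fin n => s + 2)).subset ?_
  rintro α ⟨v, hv⟩ j
  by_contra h
  refine hv ?_
  have h' : s + 2 ≤ α j := by
    simp only [Finsupp.equivFunOnFinite_symm_apply_apply] at h
    omega
  simp [phi, genStructConst, hw.iterBracket_eq_zero hs X h']

/-- The functional whose value at `X_i` is the extremal polynomial `P_i^v`. -/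
def extremalFunctional (hw : IsHallEnumeration s w) (hs : 1 ≤ s) (v : Fin n → ℝ) :
    hallLie w →ₗ[ℝ] MvPolynomial (Fin n) ℝ :=
  expFunctional (hallLieField w) (coordFunctional (hw.hallBasis hs) v) (s + 2) (List.finRange n)

theorem extremalPoly_eq (hw : IsHallEnumeration s w) (hs : 1 ≤ s) (v : Fin n → ℝ) (i : Fin n) :
    extremalPoly (hw.hallBasis hs) v i = hw.extremalFunctional hs v (hallLieField w i) := by
  have hX : ⇑(hw.hallBasis hs) = hallLieField w := funext (hw.hallBasis_apply hs)
  have hc : ∀ α, coeff α (hw.extremalFunctional hs v (hallLieField w i)) =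
      phi (hw.hallBasis hs) i α v := by
    intro α
    rw [extremalFunctional, coeff_expFunctional_finRange _ _ fun j => hw.ad_pow_eq_zero hs _,
      coordFunctional_apply, phi]
    simp only [genStructConst, hX]
  rw [extremalPoly, finsum_eq_sum_of_support_subset
    (s := (hw.extremalFunctional hs v (hallLieField w i)).support)]
  · simp only [← hc]
    exact support_sum_monomial_coeff _
  · intro α hα
    rw [Finset.mem_coe, mem_support_iff, hc]
    intro h
    exact hα (by simp [h])

/-- Elimination gives the case of generators; the Jacobi identity matches the commutator of
derivations with the bracket in 𝔤. -/
theorem hallLie_extremalFunctional (hw : IsHallEnumeration s w) (hs : 1 ≤ s) (v : Fin n → ℝ)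
    {Y : PolyField n} (hY : Y ∈ hallLie w) (Z : hallLie w) :
    Y (hw.extremalFunctional hs v Z) = hw.extremalFunctional hs v ⁅(⟨Y, hY⟩ : hallLie w), Z⁆ := by
  induction hY using LieSubalgebra.lieSpan_induction generalizing Z with
  | mem Y h =>
    obtain ⟨q, rfl⟩ := h
    exact hw.generatorField_expFunctional hs (hw.evalLie_hallLieGen_eq_zero hs)
      (fun i => hw.ad_pow_eq_zero hs _) q _ Z
  | zero =>
    have h : (⟨0, (hallLie w).zero_mem⟩ : hallLie w) = 0 := rfl
    rw [Derivation.zero_apply, h, zero_lie, map_zero]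
  | add Y Y' hY hY' ih ih' =>
    have h : (⟨Y + Y', (hallLie w).add_mem hY hY'⟩ : hallLie w) = ⟨Y, hY⟩ + ⟨Y', hY'⟩ := rfl
    rw [Derivation.add_apply, ih, ih', h, add_lie, map_add]
  | smul a Y hY ih =>
    have h : (⟨a • Y, (hallLie w).smul_mem a hY⟩ : hallLie w) = a • ⟨Y, hY⟩ := rfl
    rw [Derivation.smul_apply, ih, h, smul_lie, map_smul]
  | lie Y Y' hY hY' ih ih' =>
    have h : (⟨⁅Y, Y'⁆, (hallLie w).lie_mem hY hY'⟩ : hallLie w) =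
      ⁅(⟨Y, hY⟩ : hallLie w), (⟨Y', hY'⟩ : hallLie w)⁆ := rfl
    rw [Derivation.commutator_apply, ih, ih', ih', ih, h, lie_lie, map_sub]

theorem extremalFunctional_eq_sum (hw : IsHallEnumeration s w) (hs : 1 ≤ s) (v : Fin n → ℝ)
    (Z : hallLie w) : hw.extremalFunctional hs v Z =
      ∑ k, (hw.hallBasis hs).repr Z k • extremalPoly (hw.hallBasis hs) v k := by
  conv_lhs => rw [← (hw.hallBasis hs).sum_repr Z]
  rw [map_sum]
  exact Finset.sum_congr rfl fun k _ => by
    rw [map_smul, hw.extremalPoly_eq hs, hw.hallBasis_apply hs]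

end IsHallEnumeration

end HallLie

end HallGG

end

theorem mainTheorem4 (r s n : ℕ) (hr : 2 ≤ r) (hs : 2 ≤ s)
    (w : Fin n → FreeMagma (Fin r)) (hw : HallGG.IsHallEnumeration s w) :
    (∃ e : HallGG.FreeNilpotent r s ≃ₗ⁅ℝ⁆ HallGG.hallLie w,
      ∀ q : Fin r, (e (HallGG.FreeNilpotent.gen r s q) : HallGG.PolyField n) =
        HallGG.generatorField w q) ∧
    ∃ X : Module.Basis (Fin n) ℝ (HallGG.hallLie w),
      (∀ i, (X i : HallGG.PolyField n) = HallGG.hallField w i) ∧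
      (∀ i, {α : Fin n →₀ ℕ | ∃ v : Fin n → ℝ, HallGG.phi X i α v ≠ 0}.Finite) ∧
      ∀ v : Fin n → ℝ,
        (∀ i j, (X i : HallGG.PolyField n) (HallGG.extremalPoly X v j) =
          ∑ k, HallGG.structConst X i j k • HallGG.extremalPoly X v k) ∧
        (∀ i, (X i : HallGG.PolyField n) (HallGG.extremalPoly X v i) = 0) ∧
        (∀ Y ∈ HallGG.hallLie w,
          ∀ Q ∈ Submodule.span ℝ (Set.range (HallGG.extremalPoly X v)),
            Y Q ∈ Submodule.span ℝ (Set.range (HallGG.extremalPoly X v))) := by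
  have hs1 : 1 ≤ s := by omega
  obtain ⟨e, he⟩ := hw.exists_freeNilpotent_equiv hs1
  refine ⟨⟨e, fun q => congrArg Subtype.val (he q)⟩, hw.hallBasis hs1, fun i => ?_,
    hw.finite_phi_ne_zero hs1 _, fun v => ?_⟩
  · rw [hw.hallBasis_apply]
    exact HallGG.coe_hallLieField i
  have hmain : ∀ (Y : HallGG.PolyField n) (hY : Y ∈ HallGG.hallLie w) (j : Fin n),
      Y (HallGG.extremalPoly (hw.hallBasis hs1) v j) =
        hw.extremalFunctional hs1 v ⁅(⟨Y, hY⟩ : HallGG.hallLie w), hw.hallBasis hs1 j⁆ := by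
    intro Y hY j
    rw [hw.extremalPoly_eq, hw.hallLie_extremalFunctional hs1 v hY, hw.hallBasis_apply]
  refine ⟨fun i j => ?_, fun i => ?_, fun Y hY Q hQ => ?_⟩
  -- Expanding [X_i, X_j] in the basis makes the structure constants appear by definition.
  · rw [hmain _ (hw.hallBasis hs1 i).2, hw.extremalFunctional_eq_sum]
    rfl
  · rw [hmain _ (hw.hallBasis hs1 i).2, lie_self, map_zero]
  · induction hQ using Submodule.span_induction with
    | mem Q hQ =>
      obtain ⟨j, rfl⟩ := hQ
      rw [hmain Y hY, hw.extremalFunctional_eq_sum]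
      exact Submodule.sum_mem _ fun k _ =>
        Submodule.smul_mem _ _ (Submodule.subset_span ⟨k, rfl⟩)
    | zero => rw [map_zero]; exact Submodule.zero_mem _
    | add Q Q' _ _ h h' => rw [map_add]; exact Submodule.add_mem _ h h'
    | smul a Q _ h => rw [Derivation.map_smul]; exact Submodule.smul_mem _ a h
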